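/- Let $M$ be a smooth $n$-dimensional manifold and let $F=\alpha+\beta$ be a (smooth) Randers metric on $M$: $\alpha=\sqrt{a_{ij}(x)y^iy^j}$ is a Riemannian metric and $\beta=b_i(x)y^i$ a 1-form with $\|\beta\|_\alpha(x)=\sup_{y\in T_xM}\beta(y)/\alpha(y)<1$ for all $x\in M$. For a metric $L$ ($L=F$ or $L=\alpha$) put, in local coordinates $(x^i,y^i)$ of $TM$, $g_{ij}=\tfrac12[L^2]_{y^iy^j}$, $g_y(u,v)=g_{ij}(x,y)u^iv^j$, $$G^i=\tfrac14 g^{il}\Big\{2\frac{\partial g_{jl}}{\partial x^k}-\frac{\partial g_{jk}}{\partial x^l}\Big\}y^jy^k,\qquad R^i_{\ k}=2\frac{\partial G^i}{\partial x^k}-y^j\frac{\partial^2G^i}{\partial x^j\partial y^k}+2G^j\frac{\partial^2G^i}{\partial y^j\partial y^k}-\frac{\partial G^i}{\partial y^j}\frac{\partial G^j}{\partial y^k}.$$ The flag curvature of $F$ is $$\mathbf K(P,y)=\frac{g_y(R_y(u),u)}{g_y(y,y)g_y(u,u)-g_y(y,u)^2},\qquad P=\mathrm{span}\{y,u\},\quad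 R_y(u)=R^i_{\ k}(x,y)u^k\frac{\partial}{\partial x^i},$$ and its S-curvature is $\mathbf S(y)=\frac{\partial G^i}{\partial y^i}-y^i\frac{\partial}{\partial x^i}\ln\sigma_F(x)$ for $y\neq0$, where $\sigma_F(x)=\mathrm{Vol}(\mathbb B^n(1))/\mathrm{Vol}\{(y^i)\in\mathbb R^n: F(y^i\partial/\partial x^i|_x)<1\}$ is the density of the Busemann–Hausdorff volume form. Let $|$ denote covariant differentiation with respect to the Levi-Civita connection of $\alpha$, and set $s_{ij}=\tfrac12(b_{i|j}-b_{j|i})$, $s^i_{\ j}=a^{ik}s_{kj}$, $s_j=b_is^i_{\ j}$, $y_k=a_{jk}y^j$; an index $0$ denotes contraction with $y$, e.g. $s_0=s_py^p$, $s_{k0}=s_{kp}y^p$, $s^i_{\ 0}=s^i_{\ p}y^p$, $s_{0|k}=s_{p|k}y^p$, $s_{0|0}=s_{p|q}y^py^q$, $s^i_{\ 0|k}=s^i_{\ p|k}y^p$. Let $\bar R^i_{\ k}$ be the Riemann curvature $R^i_{\ k}$ of $\alpha$. Theorem. Suppose that $\mathbf S=0$. Then $\mathbf K=0$ (that is, $\mathbf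 K(P,y)=0$ for every tangent plane $P$ and every nonzero $y\in P$) if and only if the following two equations hold in all local coordinate systems, at every point $x$, for all $y\in T_xM$ and all indices $i,k$: $$\begin{aligned}\bar R^i_{\ k}={}&-\big(s_{0|0}\delta^i_k-s_{0|k}y^i\big)-\big(s_{k|0}-s_{0|k}\big)y^i-s_0\big(s_0\delta^i_k-s_ky^i\big)\\&+\big(\alpha^2s^i_{\ j}s^j_{\ k}-s^i_{\ j}s^j_{\ 0}y_k\big)-3s_{k0}s^i_{\ 0},\\ 0={}&s_js^j_{\ 0}\big(\alpha^2\delta^i_k-y_ky^i\big)+\alpha^2\big(s_js^j_{\ 0}\delta^i_k-s_js^j_{\ k}y^i\big)\\&+\alpha^2\big(s^i_{\ k|0}-s^i_{\ 0|k}\big)-\big(\alpha^2s^i_{\ 0|k}-s^i_{\ 0|0}y_k\big).\end{aligned}$$ -/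

import Mathlib

open scoped Manifold ContDiff

noncomputable section

namespace Randers

/-! ### Finsler geometry in a coordinate system

A function `L x y` of a point `x` and a tangent vector `y`, both in coordinates, is the local
expression of a (Finsler) metric. Only values with `x` in an open coordinate domain matter, and
all objects depend only on the germ of `L` at `(x, y)` (the volume density: on the germ in `x`). -/

/-- Coordinate space. -/
abbrev Coord (n : ℕ) : Type := EuclideanSpace ℝ (Fin n)

/-- The partial derivative `∂f/∂x^i` of a function of the position. -/
def pd {n : ℕ} (i : Fin n) (f : Coord n → ℝ) (x : Coord n) : ℝ :=
  fderiv ℝ f x (EuclideanSpace.single i 1)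

/-- The partial derivative `∂f/∂x^i` of a function of position and velocity. -/
def pdx {n : ℕ} (i : Fin n) (f : Coord n → Coord n → ℝ) (x y : Coord n) : ℝ :=
  pd i (fun x' => f x' y) x

/-- The partial derivative `∂f/∂y^i` of a function of position and velocity. -/
def pdy {n : ℕ} (i : Fin n) (f : Coord n → Coord n → ℝ) (x y : Coord n) : ℝ :=
  pd i (fun y' => f x y') y

/-- The Kronecker symbol. -/
def kron {n : ℕ} (i k : Fin n) : ℝ := if i = k then 1 else 0

/-- The fundamental tensor `g_ij(x, y) = (1/2) ∂²(L²)/∂y^i∂y^j`. -/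
def fundTensor {n : ℕ} (L : Coord n → Coord n → ℝ) (x y : Coord n) : Matrix (Fin n) (Fin n) ℝ :=
  Matrix.of fun i j => (1 / 2) * pdy j (pdy i (fun x y => L x y ^ 2)) x y

/-- The bilinear form `g_y(u, v) = g_ij(x, y) u^i v^j`. -/
def fundForm {n : ℕ} (L : Coord n → Coord n → ℝ) (x y u v : Coord n) : ℝ :=
  ∑ i, ∑ j, fundTensor L x y i j * u i * v j

/-- The geodesic coefficients
`G^i = (1/4) g^{il} (2 ∂g_jl/∂x^k - ∂g_jk/∂x^l) y^j y^k`. -/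
def geodesicCoeff {n : ℕ} (L : Coord n → Coord n → ℝ) (i : Fin n) (x y : Coord n) : ℝ :=
  (1 / 4) * ∑ l, (fundTensor L x y)⁻¹ i l *
    ∑ j, ∑ k, (2 * pdx k (fun x y => fundTensor L x y j l) x y
      - pdx l (fun x y => fundTensor L x y j k) x y) * y j * y k

/-- The Riemann curvature `R^i_k(x, y)` of a metric. -/
def riemannCurv {n : ℕ} (L : Coord n → Coord n → ℝ) (i k : Fin n) (x y : Coord n) : ℝ :=
  2 * pdx k (geodesicCoeff L i) x y
    - ∑ j, y j * pdx j (pdy k (geodesicCoeff L i)) x y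
    + 2 * ∑ j, geodesicCoeff L j x y * pdy j (pdy k (geodesicCoeff L i)) x y
    - ∑ j, pdy j (geodesicCoeff L i) x y * pdy k (geodesicCoeff L j) x y

/-- The vector `R_y(u) = R^i_k(x, y) u^k ∂_i`. -/
def riemannMap {n : ℕ} (L : Coord n → Coord n → ℝ) (x y u : Coord n) : Coord n :=
  WithLp.toLp 2 fun i => ∑ k, riemannCurv L i k x y * u k

/-- The flag curvature `K(P, y)` of the flag with `P = span {y, u}`. -/
def flagCurvature {n : ℕ} (L : Coord n → Coord n → ℝ) (x y u : Coord n) : ℝ :=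
  fundForm L x y (riemannMap L x y u) u /
    (fundForm L x y y y * fundForm L x y u u - fundForm L x y y u * fundForm L x y y u)

/-- The density `σ(x)` of the Busemann-Hausdorff volume form. -/
def volumeDensity {n : ℕ} (L : Coord n → Coord n → ℝ) (x : Coord n) : ℝ :=
  MeasureTheory.volume.real (Metric.ball (0 : Coord n) 1) /
    MeasureTheory.volume.real {y : Coord n | L x y < 1}

/-- The S-curvature `S(x, y) = ∂G^i/∂y^i - y^i ∂(ln σ)/∂x^i`. -/
def sCurvature {n : ℕ} (L : Coord n → Coord n → ℝ) (x y : Coord n) : ℝ :=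
  ∑ i, pdy i (geodesicCoeff L i) x y
    - ∑ i, y i * pd i (fun x => Real.log (volumeDensity L x)) x

/-! ### Tensor calculus of a Riemannian metric `a_ij` and a 1-form `b_i` in coordinates -/

section Tensors

variable {n : ℕ} (a : Coord n → Matrix (Fin n) (Fin n) ℝ) (b : Coord n → Fin n → ℝ)

/-- The Christoffel symbol `Γ^k_ij` of `a`. -/
def christoffel (k i j : Fin n) (x : Coord n) : ℝ :=
  (1 / 2) * ∑ l, (a x)⁻¹ k l *
    (pd i (fun x => a x j l) x + pd j (fun x => a x i l) x - pd l (fun x => a x i j) x)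

/-- `covOne a w i j x` is `w_{i|j}`, for a covector field `w_i`. -/
def covOne (w : Coord n → Fin n → ℝ) (i j : Fin n) (x : Coord n) : ℝ :=
  pd j (fun x => w x i) x - ∑ k, christoffel a k i j x * w x k

/-- `covMixed a T i j k x` is `T^i_{j|k}`, for a tensor field `T^i_j`. -/
def covMixed (T : Coord n → Fin n → Fin n → ℝ) (i j k : Fin n) (x : Coord n) : ℝ :=
  pd k (fun x => T x i j) x + ∑ l, christoffel a i k l x * T x l j
    - ∑ l, christoffel a l k j x * T x i l

/-- `s_ij = (b_{i|j} - b_{j|i}) / 2`. -/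
def sLow (x : Coord n) (i j : Fin n) : ℝ := (covOne a b i j x - covOne a b j i x) / 2

/-- `s^i_j = a^{ik} s_kj`. -/
def sUp (x : Coord n) (i j : Fin n) : ℝ := ∑ k, (a x)⁻¹ i k * sLow a b x k j

/-- `s_j = b_i s^i_j`. -/
def sVec (x : Coord n) (j : Fin n) : ℝ := ∑ i, b x i * sUp a b x i j

/-- `s_{i|j}`. -/
def sVecCov (i j : Fin n) (x : Coord n) : ℝ := covOne a (sVec a b) i j x

/-- `s^i_{j|k}`. -/
def sUpCov (i j k : Fin n) (x : Coord n) : ℝ := covMixed a (sUp a b) i j k x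

/-- `α² = a_ij y^i y^j`. -/
def alphaSq (x y : Coord n) : ℝ := ∑ i, ∑ j, a x i j * y i * y j

/-- `y_k = a_jk y^j`. -/
def yLow (k : Fin n) (x y : Coord n) : ℝ := ∑ j, a x j k * y j

/-- `s_0 = s_p y^p`. -/
def s_0 (x y : Coord n) : ℝ := ∑ p, sVec a b x p * y p

/-- `s_{k0} = s_kp y^p`. -/
def sLow_0 (k : Fin n) (x y : Coord n) : ℝ := ∑ p, sLow a b x k p * y p

/-- `s^i_0 = s^i_p y^p`. -/
def sUp_0 (i : Fin n) (x y : Coord n) : ℝ := ∑ p, sUp a b x i p * y p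

/-- `s_{0|k} = s_{p|k} y^p`. -/
def s_0_cov (k : Fin n) (x y : Coord n) : ℝ := ∑ p, sVecCov a b p k x * y p

/-- `s_{k|0} = s_{k|p} y^p`. -/
def s_cov_0 (k : Fin n) (x y : Coord n) : ℝ := ∑ p, sVecCov a b k p x * y p

/-- `s_{0|0} = s_{p|q} y^p y^q`. -/
def s_0_cov_0 (x y : Coord n) : ℝ := ∑ p, ∑ q, sVecCov a b p q x * y p * y q

/-- `s^i_{k|0} = s^i_{k|p} y^p`. -/
def sUp_cov_0 (i k : Fin n) (x y : Coord n) : ℝ := ∑ p, sUpCov a b i k p x * y p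

/-- `s^i_{0|k} = s^i_{p|k} y^p`. -/
def sUp_0_cov (i k : Fin n) (x y : Coord n) : ℝ := ∑ p, sUpCov a b i p k x * y p

/-- `s^i_{0|0} = s^i_{p|q} y^p y^q`. -/
def sUp_0_cov_0 (i : Fin n) (x y : Coord n) : ℝ :=
  ∑ p, ∑ q, sUpCov a b i p q x * y p * y q

end Tensors

/-! ### Randers metrics on manifolds -/

section Manifold

variable (n : ℕ) (M : Type*) [TopologicalSpace M] [ChartedSpace (Coord n) M]
  [IsManifold (𝓡 n) ∞ M]

/-- A smooth 1-form on `M`. -/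
structure OneForm where
  /-- The value at a point. -/
  toFun (p : M) : TangentSpace (𝓡 n) p →L[ℝ] ℝ
  contMDiff : ContMDiff (𝓡 n) ((𝓡 n).prod 𝓘(ℝ, Coord n →L[ℝ] ℝ)) ∞
    (fun p => Bundle.TotalSpace.mk' (Coord n →L[ℝ] ℝ)
      (E := fun p : M => TangentSpace (𝓡 n) p →L[ℝ] ℝ) p (toFun p))

variable {n M} in
/-- `‖β‖_α(p) = sup_v β(v) / α(v)` (the vector `v = 0` contributes the value `0`). -/
def formNorm
    (g : Bundle.ContMDiffRiemannianMetric (𝓡 n) ∞ (Coord n) (fun p : M => TangentSpace (𝓡 n) p))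
    (β : OneForm n M) (p : M) : ℝ :=
  ⨆ v : TangentSpace (𝓡 n) p, β.toFun p v / √(g.inner p v v)

/-- A Randers metric on the manifold `M`: a smooth Riemannian metric `α` and a smooth 1-form `β`
with `‖β‖_α < 1` at every point; the metric itself is `F = α + β`. -/
structure RandersMetric where
  /-- The Riemannian metric. -/
  g : Bundle.ContMDiffRiemannianMetric (𝓡 n) ∞ (Coord n) (fun p : M => TangentSpace (𝓡 n) p)
  /-- The 1-form. -/
  β : OneForm n M
  norm_lt_one : ∀ p : M, formNorm g β p < 1

namespace RandersMetric

variable {n M} (F : RandersMetric n M)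

/-- The Riemannian norm `α` on tangent vectors. -/
def alpha (p : M) (v : TangentSpace (𝓡 n) p) : ℝ := √(F.g.inner p v v)

/-- The Randers metric `F = α + β` on tangent vectors. -/
def norm (p : M) (v : TangentSpace (𝓡 n) p) : ℝ := F.alpha p v + F.β.toFun p v

end RandersMetric

variable {n M}

/-- The tangent vector `y^i ∂/∂x^i` at the point with coordinates `x` in the chart `φ`. -/
def tangentVec (φ : OpenPartialHomeomorph M (Coord n)) (x y : Coord n) :
    TangentSpace (𝓡 n) (φ.symm x) :=
  mfderiv (𝓡 n) (𝓡 n) φ.symm x y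

/-- The expression in the chart `φ` of a function on the tangent bundle. -/
def localExpr (N : (p : M) → TangentSpace (𝓡 n) p → ℝ)
    (φ : OpenPartialHomeomorph M (Coord n)) (x y : Coord n) : ℝ :=
  N (φ.symm x) (tangentVec φ x y)

/-- The S-curvature of the metric `N` vanishes: `S(y) = 0` for every nonzero tangent vector `y`,
in every local coordinate system. -/
def SCurvatureVanishes (N : (p : M) → TangentSpace (𝓡 n) p → ℝ) : Prop :=
  ∀ φ ∈ IsManifold.maximalAtlas (𝓡 n) ∞ M, ∀ x ∈ φ.target, ∀ y : Coord n, y ≠ 0 →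
    sCurvature (localExpr N φ) x y = 0

/-- The flag curvature of the metric `N` vanishes: `K(P, y) = 0` for every tangent plane
`P = span {y, u}`, in every local coordinate system. -/
def FlagCurvatureVanishes (N : (p : M) → TangentSpace (𝓡 n) p → ℝ) : Prop :=
  ∀ φ ∈ IsManifold.maximalAtlas (𝓡 n) ∞ M, ∀ x ∈ φ.target, ∀ y u : Coord n,
    LinearIndependent ℝ ![y, u] → flagCurvature (localExpr N φ) x y u = 0

namespace RandersMetric

variable (F : RandersMetric n M)

/-- The components `a_ij` of the Riemannian metric in the chart `φ`. -/
def a (φ : OpenPartialHomeomorph M (Coord n)) (x : Coord n) : Matrix (Fin n) (Fin n) ℝ :=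
  Matrix.of fun i j => F.g.inner (φ.symm x) (tangentVec φ x (EuclideanSpace.single i 1))
    (tangentVec φ x (EuclideanSpace.single j 1))

/-- The components `b_i` of the 1-form in the chart `φ`. -/
def b (φ : OpenPartialHomeomorph M (Coord n)) (x : Coord n) (i : Fin n) : ℝ :=
  F.β.toFun (φ.symm x) (tangentVec φ x (EuclideanSpace.single i 1))

/-- The first equation, for the Riemann curvature of `α`, with `a_ij`, `b_i` the components of
`α`, `β` in the chart `φ`, at the coordinates `x`, `y` and with the indices `i`, `k`. -/
def RiemannEquation (φ : OpenPartialHomeomorph M (Coord n)) (x y : Coord n) (i k : Fin n) : Prop :=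
  let a := F.a φ
  let b := F.b φ
  riemannCurv (localExpr F.alpha φ) i k x y =
    -(s_0_cov_0 a b x y * kron i k - s_0_cov a b k x y * y i)
    - (s_cov_0 a b k x y - s_0_cov a b k x y) * y i
    - s_0 a b x y * (s_0 a b x y * kron i k - sVec a b x k * y i)
    + (alphaSq a x y * ∑ j, sUp a b x i j * sUp a b x j k
        - (∑ j, sUp a b x i j * sUp_0 a b j x y) * yLow a k x y)
    - 3 * sLow_0 a b k x y * sUp_0 a b i x y

/-- The second equation, with the same conventions. -/
def SecondEquation (φ : OpenPartialHomeomorph M (Coord n)) (x y : Coord n) (i k : Fin n) : Prop :=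
  let a := F.a φ
  let b := F.b φ
  0 = (∑ j, sVec a b x j * sUp_0 a b j x y)
        * (alphaSq a x y * kron i k - yLow a k x y * y i)
    + alphaSq a x y * ((∑ j, sVec a b x j * sUp_0 a b j x y) * kron i k
        - (∑ j, sVec a b x j * sUp a b x j k) * y i)
    + alphaSq a x y * (sUp_cov_0 a b i k x y - sUp_0_cov a b i k x y)
    - (alphaSq a x y * sUp_0_cov a b i k x y - sUp_0_cov_0 a b i x y * yLow a k x y)

end RandersMetric

end Manifold

end Randers

end

/-!
In a chart `F = α + β` is given by components `a_ij`, `b_i`, and its spray is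
`G^i = Ḡ^i + (e_00 / (2F) - s_0) y^i + α s^i_0`, where `Ḡ^i` is the spray of `α` and
`e_00 = b_{i|j} y^i y^j + 2 s_0 β`. This is proved without inverting the fundamental tensor: `F`
is horizontally constant for this homogeneous spray (`IsRandersPair.pdx_randers_eq`), and such a
spray is the geodesic spray as soon as the fundamental tensor is invertible
(`geodesicCoeff_eq_of_horizontal`).

The divergence `∂G^i/∂y^i` is `(n + 1) e_00 / (2F)` up to terms linear in `y`, and the term of the
S-curvature that involves the volume density is linear in `y` whatever the density is. So `S = 0`
makes `e_00 / (2F)` linear in `y`. Comparing the values at `y` and `-y`, where `e_00` is even and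
`F` takes the values `α + β` and `α - β`, gives `e_00 = 0` (`IsRandersPair.eForm_eq_zero`).

Hence `G^i = Ḡ^i - s_0 y^i + α s^i_0`, and a computation of the Riemann curvature of this spray
gives `R^i_k = (R̄^i_k - E^i_k) - O^i_k / α` (`IsRandersPair.sprayCurv_dev`), where `E^i_k` and
`O^i_k` are the right-hand sides of the two equations. The first summand is even in `y` and the
second is odd, so that `R^i_k` vanishes for all `y` if and only if both do
(`IsRandersPair.riemannCurv_eq_zero_iff`).

Finally `K = 0` is equivalent to `R^i_k = 0`. The fundamental tensor is positive definite, so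
`K = 0` says that the quadratic form `g_y(R_y(u), u)` vanishes for `u` not proportional to `y`;
for the remaining `u` it vanishes since `R_y(y) = 0` (`sprayCurv_y`). As `R_y` is self-adjoint
with respect to `g_y`, polarisation gives `R_y = 0`. Self-adjointness holds for every spray that
leaves a function `L` on the tangent bundle horizontally constant, with respect to the vertical
Hessian of `L` (`sprayCurv_selfAdjoint`): differentiating the invariance of `L` expresses
`L_im R^i_k` by terms that are symmetric in `k` and `m`.
-/

noncomputable section

namespace Randers

/-! ### Partial derivatives of functions of position and velocity -/

section Calculus

variable {n : ℕ}

/-- The coordinate direction `∂/∂x^k` at a point of the tangent bundle. -/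
def dirX (k : Fin n) : Coord n × Coord n := (EuclideanSpace.single k 1, 0)

/-- The coordinate direction `∂/∂y^k` at a point of the tangent bundle. -/
def dirY (k : Fin n) : Coord n × Coord n := (0, EuclideanSpace.single k 1)

/-- Smoothness of a function of position and velocity on a set, jointly in both variables. -/
def SmoothOn (Ω : Set (Coord n × Coord n)) (f : Coord n → Coord n → ℝ) : Prop :=
  ContDiffOn ℝ ∞ (fun z : Coord n × Coord n => f z.1 z.2) Ω

variable {Ω : Set (Coord n × Coord n)} {f g : Coord n → Coord n → ℝ} {x y : Coord n}

namespace SmoothOn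

theorem contDiffAt (hf : SmoothOn Ω f) (hΩ : IsOpen Ω) (h : (x, y) ∈ Ω) :
    ContDiffAt ℝ ∞ (fun z : Coord n × Coord n => f z.1 z.2) (x, y) :=
  ContDiffOn.contDiffAt hf (hΩ.mem_nhds h)

theorem differentiableAt (hf : SmoothOn Ω f) (hΩ : IsOpen Ω) (h : (x, y) ∈ Ω) :
    DifferentiableAt ℝ (fun z : Coord n × Coord n => f z.1 z.2) (x, y) :=
  (hf.contDiffAt hΩ h).differentiableAt (by simp)

theorem diff_left (hf : SmoothOn Ω f) (hΩ : IsOpen Ω) (h : (x, y) ∈ Ω) :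
    DifferentiableAt ℝ (fun x' => f x' y) x :=
  (hf.differentiableAt hΩ h).comp (f := fun x' => (x', y)) x (by fun_prop)

theorem diff_right (hf : SmoothOn Ω f) (hΩ : IsOpen Ω) (h : (x, y) ∈ Ω) :
    DifferentiableAt ℝ (fun y' => f x y') y :=
  (hf.differentiableAt hΩ h).comp (f := fun y' => (x, y')) y (by fun_prop)

theorem pdx_eq (hf : SmoothOn Ω f) (hΩ : IsOpen Ω) (h : (x, y) ∈ Ω) (k : Fin n) :
    pdx k f x y = fderiv ℝ (fun z : Coord n × Coord n => f z.1 z.2) (x, y) (dirX k) := by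
  have h1 : HasFDerivAt (fun x' : Coord n => (x', y))
      (ContinuousLinearMap.inl ℝ (Coord n) (Coord n)) x := hasFDerivAt_prodMk_left x y
  have h2 := (hf.differentiableAt hΩ h).hasFDerivAt.comp x h1
  have h3 := h2.fderiv
  unfold pdx pd
  simp only [Function.comp_def] at h3
  rw [h3]
  simp [dirX]

theorem pdy_eq (hf : SmoothOn Ω f) (hΩ : IsOpen Ω) (h : (x, y) ∈ Ω) (k : Fin n) :
    pdy k f x y = fderiv ℝ (fun z : Coord n × Coord n => f z.1 z.2) (x, y) (dirY k) := by
  have h1 : HasFDerivAt (fun y' : Coord n => (x, y'))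
      (ContinuousLinearMap.inr ℝ (Coord n) (Coord n)) y := hasFDerivAt_prodMk_right x y
  have h2 := (hf.differentiableAt hΩ h).hasFDerivAt.comp y h1
  have h3 := h2.fderiv
  unfold pdy pd
  simp only [Function.comp_def] at h3
  rw [h3]
  simp [dirY]

theorem congr (hf : SmoothOn Ω f) (h : ∀ z ∈ Ω, g z.1 z.2 = f z.1 z.2) : SmoothOn Ω g :=
  ContDiffOn.congr hf h

theorem dir (hf : SmoothOn Ω f) (hΩ : IsOpen Ω) (v : Coord n × Coord n) :
    ContDiffOn ℝ ∞
      (fun z => fderiv ℝ (fun z : Coord n × Coord n => f z.1 z.2) z v) Ω :=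
  (ContDiffOn.fderiv_of_isOpen hf hΩ (m := ∞) (by simp)).clm_apply contDiffOn_const

theorem pdx (hf : SmoothOn Ω f) (hΩ : IsOpen Ω) (k : Fin n) : SmoothOn Ω (pdx k f) :=
  (hf.dir hΩ (dirX k)).congr fun _ hz => hf.pdx_eq hΩ hz k

theorem pdy (hf : SmoothOn Ω f) (hΩ : IsOpen Ω) (k : Fin n) : SmoothOn Ω (pdy k f) :=
  (hf.dir hΩ (dirY k)).congr fun _ hz => hf.pdy_eq hΩ hz k

theorem const (c : ℝ) : SmoothOn Ω (fun _ _ => c) := contDiffOn_const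

theorem add (hf : SmoothOn Ω f) (hg : SmoothOn Ω g) : SmoothOn Ω (fun x y => f x y + g x y) :=
  ContDiffOn.add hf hg

theorem sub (hf : SmoothOn Ω f) (hg : SmoothOn Ω g) : SmoothOn Ω (fun x y => f x y - g x y) :=
  ContDiffOn.sub hf hg

theorem mul (hf : SmoothOn Ω f) (hg : SmoothOn Ω g) : SmoothOn Ω (fun x y => f x y * g x y) :=
  ContDiffOn.mul hf hg

theorem div (hf : SmoothOn Ω f) (hg : SmoothOn Ω g) (h : ∀ z ∈ Ω, g z.1 z.2 ≠ 0) :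
    SmoothOn Ω (fun x y => f x y / g x y) :=
  ContDiffOn.div hf hg h

theorem sqrt (hf : SmoothOn Ω f) (h : ∀ z ∈ Ω, f z.1 z.2 ≠ 0) :
    SmoothOn Ω (fun x y => √(f x y)) :=
  ContDiffOn.sqrt hf h

theorem sum {ι : Type*} {s : Finset ι} {f : ι → Coord n → Coord n → ℝ}
    (hf : ∀ i ∈ s, SmoothOn Ω (f i)) : SmoothOn Ω (fun x y => ∑ i ∈ s, f i x y) :=
  ContDiffOn.sum (f := fun i (z : Coord n × Coord n) => f i z.1 z.2) hf

/-- The velocity components are smooth. -/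
theorem vel (i : Fin n) : SmoothOn Ω (fun _ y => y i) := by
  unfold SmoothOn
  fun_prop

/-- Functions of the position alone. -/
theorem position {U : Set (Coord n)} {c : Coord n → ℝ} (hc : ContDiffOn ℝ ∞ c U)
    (h : ∀ z ∈ Ω, z.1 ∈ U) : SmoothOn Ω (fun x _ => c x) :=
  hc.comp contDiff_fst.contDiffOn h

end SmoothOn

theorem slice_left_mem (hΩ : IsOpen Ω) (h : (x, y) ∈ Ω) : ∀ᶠ x' in nhds x, (x', y) ∈ Ω :=
  (Continuous.continuousAt (f := fun x' => (x', y)) (by fun_prop)).eventually (hΩ.mem_nhds h)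

theorem slice_right_mem (hΩ : IsOpen Ω) (h : (x, y) ∈ Ω) : ∀ᶠ y' in nhds y, (x, y') ∈ Ω :=
  (Continuous.continuousAt (f := fun y' => (x, y')) (by fun_prop)).eventually (hΩ.mem_nhds h)

theorem pdx_congr (hΩ : IsOpen Ω) (h : (x, y) ∈ Ω)
    (hfg : ∀ x y, (x, y) ∈ Ω → f x y = g x y) (k : Fin n) : pdx k f x y = pdx k g x y := by
  have : (fun x' => f x' y) =ᶠ[nhds x] (fun x' => g x' y) :=
    (slice_left_mem hΩ h).mono fun x' hx' => hfg x' y hx'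
  unfold pdx pd
  rw [this.fderiv_eq]

theorem pdy_congr (hΩ : IsOpen Ω) (h : (x, y) ∈ Ω)
    (hfg : ∀ x y, (x, y) ∈ Ω → f x y = g x y) (k : Fin n) : pdy k f x y = pdy k g x y := by
  have : (fun y' => f x y') =ᶠ[nhds y] (fun y' => g x y') :=
    (slice_right_mem hΩ h).mono fun y' hy' => hfg x y' hy'
  unfold pdy pd
  rw [this.fderiv_eq]

theorem dir_comm (hf : SmoothOn Ω f) (hΩ : IsOpen Ω) (h : (x, y) ∈ Ω) (v w : Coord n × Coord n) :
    fderiv ℝ (fun z => fderiv ℝ (fun z : Coord n × Coord n => f z.1 z.2) z v) (x, y) w =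
      fderiv ℝ (fun z => fderiv ℝ (fun z : Coord n × Coord n => f z.1 z.2) z w) (x, y) v := by
  have hd : DifferentiableAt ℝ (fderiv ℝ (fun z : Coord n × Coord n => f z.1 z.2)) (x, y) :=
    ((hf.contDiffAt hΩ h).fderiv_right (m := 1)
      (WithTop.coe_le_coe.2 (le_top : (1 + 1 : ℕ∞) ≤ ⊤))).differentiableAt (by simp)
  have hs : IsSymmSndFDerivAt ℝ (fun z : Coord n × Coord n => f z.1 z.2) (x, y) :=
    (hf.contDiffAt hΩ h).isSymmSndFDerivAt (by
      rw [minSmoothness_of_isRCLikeNormedField]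
      exact WithTop.coe_le_coe.2 (le_top : (2 : ℕ∞) ≤ ⊤))
  rw [fderiv_clm_apply hd (by fun_prop), fderiv_clm_apply hd (by fun_prop)]
  simpa using hs.eq w v

theorem pdx_pdy_comm (hf : SmoothOn Ω f) (hΩ : IsOpen Ω) (h : (x, y) ∈ Ω) (k m : Fin n) :
    pdx k (pdy m f) x y = pdy m (pdx k f) x y := by
  rw [(hf.pdy hΩ m).pdx_eq hΩ h, (hf.pdx hΩ k).pdy_eq hΩ h]
  have e1 : (fun z : Coord n × Coord n => pdy m f z.1 z.2) =ᶠ[nhds (x, y)]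
      fun z => fderiv ℝ (fun z : Coord n × Coord n => f z.1 z.2) z (dirY m) :=
    (hΩ.mem_nhds h |> Filter.eventually_of_mem) fun z hz => hf.pdy_eq hΩ hz m
  have e2 : (fun z : Coord n × Coord n => pdx k f z.1 z.2) =ᶠ[nhds (x, y)]
      fun z => fderiv ℝ (fun z : Coord n × Coord n => f z.1 z.2) z (dirX k) :=
    (hΩ.mem_nhds h |> Filter.eventually_of_mem) fun z hz => hf.pdx_eq hΩ hz k
  rw [e1.fderiv_eq, e2.fderiv_eq, dir_comm hf hΩ h]

theorem pdy_pdy_comm (hf : SmoothOn Ω f) (hΩ : IsOpen Ω) (h : (x, y) ∈ Ω) (k m : Fin n) :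
    pdy k (pdy m f) x y = pdy m (pdy k f) x y := by
  rw [(hf.pdy hΩ m).pdy_eq hΩ h, (hf.pdy hΩ k).pdy_eq hΩ h]
  have e (m : Fin n) : (fun z : Coord n × Coord n => pdy m f z.1 z.2) =ᶠ[nhds (x, y)]
      fun z => fderiv ℝ (fun z : Coord n × Coord n => f z.1 z.2) z (dirY m) :=
    (hΩ.mem_nhds h |> Filter.eventually_of_mem) fun z hz => hf.pdy_eq hΩ hz m
  rw [(e m).fderiv_eq, (e k).fderiv_eq, dir_comm hf hΩ h]

theorem pdx_pdx_comm (hf : SmoothOn Ω f) (hΩ : IsOpen Ω) (h : (x, y) ∈ Ω) (k m : Fin n) :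
    pdx k (pdx m f) x y = pdx m (pdx k f) x y := by
  rw [(hf.pdx hΩ m).pdx_eq hΩ h, (hf.pdx hΩ k).pdx_eq hΩ h]
  have e (m : Fin n) : (fun z : Coord n × Coord n => pdx m f z.1 z.2) =ᶠ[nhds (x, y)]
      fun z => fderiv ℝ (fun z : Coord n × Coord n => f z.1 z.2) z (dirX m) :=
    (hΩ.mem_nhds h |> Filter.eventually_of_mem) fun z hz => hf.pdx_eq hΩ hz m
  rw [(e m).fderiv_eq, (e k).fderiv_eq, dir_comm hf hΩ h]

/-! ### Rules of differentiation -/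

theorem pd_add {f g : Coord n → ℝ} (hf : DifferentiableAt ℝ f x) (hg : DifferentiableAt ℝ g x)
    (k : Fin n) : pd k (fun x => f x + g x) x = pd k f x + pd k g x := by
  simp [pd, fderiv_fun_add hf hg]

theorem pd_sub {f g : Coord n → ℝ} (hf : DifferentiableAt ℝ f x) (hg : DifferentiableAt ℝ g x)
    (k : Fin n) : pd k (fun x => f x - g x) x = pd k f x - pd k g x := by
  simp [pd, fderiv_fun_sub hf hg]

theorem pd_mul {f g : Coord n → ℝ} (hf : DifferentiableAt ℝ f x) (hg : DifferentiableAt ℝ g x)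
    (k : Fin n) : pd k (fun x => f x * g x) x = pd k f x * g x + f x * pd k g x := by
  simp [pd, fderiv_fun_mul hf hg]; ring

theorem pd_sum {ι : Type*} {s : Finset ι} {f : ι → Coord n → ℝ}
    (hf : ∀ i ∈ s, DifferentiableAt ℝ (f i) x) (k : Fin n) :
    pd k (fun x => ∑ i ∈ s, f i x) x = ∑ i ∈ s, pd k (f i) x := by
  simp [pd, fderiv_fun_sum hf]

theorem pd_const (c : ℝ) (k : Fin n) : pd k (fun _ : Coord n => c) x = 0 := by
  simp [pd]

theorem pd_vel (i k : Fin n) : pd k (fun y : Coord n => y i) y = kron i k := by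
  have : (fun y : Coord n => y i) = EuclideanSpace.proj (𝕜 := ℝ) i := by ext; rfl
  rw [pd, this, ContinuousLinearMap.fderiv]
  simp [kron]

theorem pd_sqrt {f : Coord n → ℝ} (hf : DifferentiableAt ℝ f x) (h : f x ≠ 0) (k : Fin n) :
    pd k (fun x => √(f x)) x = pd k f x / (2 * √(f x)) := by
  simp [pd, fderiv_sqrt hf h]; ring

theorem pdx_add (hf : SmoothOn Ω f) (hg : SmoothOn Ω g) (hΩ : IsOpen Ω) (h : (x, y) ∈ Ω)
    (k : Fin n) : pdx k (fun x y => f x y + g x y) x y = pdx k f x y + pdx k g x y :=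
  pd_add (hf.diff_left hΩ h) (hg.diff_left hΩ h) k

theorem pdy_add (hf : SmoothOn Ω f) (hg : SmoothOn Ω g) (hΩ : IsOpen Ω) (h : (x, y) ∈ Ω)
    (k : Fin n) : pdy k (fun x y => f x y + g x y) x y = pdy k f x y + pdy k g x y :=
  pd_add (hf.diff_right hΩ h) (hg.diff_right hΩ h) k

theorem pdx_sub (hf : SmoothOn Ω f) (hg : SmoothOn Ω g) (hΩ : IsOpen Ω) (h : (x, y) ∈ Ω)
    (k : Fin n) : pdx k (fun x y => f x y - g x y) x y = pdx k f x y - pdx k g x y :=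
  pd_sub (hf.diff_left hΩ h) (hg.diff_left hΩ h) k

theorem pdy_sub (hf : SmoothOn Ω f) (hg : SmoothOn Ω g) (hΩ : IsOpen Ω) (h : (x, y) ∈ Ω)
    (k : Fin n) : pdy k (fun x y => f x y - g x y) x y = pdy k f x y - pdy k g x y :=
  pd_sub (hf.diff_right hΩ h) (hg.diff_right hΩ h) k

theorem pdx_mul (hf : SmoothOn Ω f) (hg : SmoothOn Ω g) (hΩ : IsOpen Ω) (h : (x, y) ∈ Ω)
    (k : Fin n) :
    pdx k (fun x y => f x y * g x y) x y = pdx k f x y * g x y + f x y * pdx k g x y :=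
  pd_mul (hf.diff_left hΩ h) (hg.diff_left hΩ h) k

theorem pdy_mul (hf : SmoothOn Ω f) (hg : SmoothOn Ω g) (hΩ : IsOpen Ω) (h : (x, y) ∈ Ω)
    (k : Fin n) :
    pdy k (fun x y => f x y * g x y) x y = pdy k f x y * g x y + f x y * pdy k g x y :=
  pd_mul (hf.diff_right hΩ h) (hg.diff_right hΩ h) k

theorem pdx_sum {ι : Type*} {s : Finset ι} {f : ι → Coord n → Coord n → ℝ}
    (hf : ∀ i ∈ s, SmoothOn Ω (f i)) (hΩ : IsOpen Ω) (h : (x, y) ∈ Ω) (k : Fin n) :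
    pdx k (fun x y => ∑ i ∈ s, f i x y) x y = ∑ i ∈ s, pdx k (f i) x y :=
  pd_sum (f := fun i x => f i x y) (fun i hi => (hf i hi).diff_left hΩ h) k

theorem pdy_sum {ι : Type*} {s : Finset ι} {f : ι → Coord n → Coord n → ℝ}
    (hf : ∀ i ∈ s, SmoothOn Ω (f i)) (hΩ : IsOpen Ω) (h : (x, y) ∈ Ω) (k : Fin n) :
    pdy k (fun x y => ∑ i ∈ s, f i x y) x y = ∑ i ∈ s, pdy k (f i) x y :=
  pd_sum (f := fun i y => f i x y) (fun i hi => (hf i hi).diff_right hΩ h) k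

theorem pdx_sqrt (hf : SmoothOn Ω f) (hΩ : IsOpen Ω) (h : (x, y) ∈ Ω) (h0 : f x y ≠ 0)
    (k : Fin n) : pdx k (fun x y => √(f x y)) x y = pdx k f x y / (2 * √(f x y)) :=
  pd_sqrt (f := fun x => f x y) (hf.diff_left hΩ h) h0 k

theorem pdy_sqrt (hf : SmoothOn Ω f) (hΩ : IsOpen Ω) (h : (x, y) ∈ Ω) (h0 : f x y ≠ 0)
    (k : Fin n) : pdy k (fun x y => √(f x y)) x y = pdy k f x y / (2 * √(f x y)) :=
  pd_sqrt (f := fun y => f x y) (hf.diff_right hΩ h) h0 k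

/-! ### Sprays -/

/-- The derivative along the spray `y^j ∂/∂x^j - 2 G^j ∂/∂y^j`. -/
def spr (G : Fin n → Coord n → Coord n → ℝ) (f : Coord n → Coord n → ℝ) (x y : Coord n) : ℝ :=
  ∑ j, (y j * pdx j f x y - 2 * (G j x y * pdy j f x y))

/-- The Riemann curvature of the spray with coefficients `G^i`. -/
def sprayCurv (G : Fin n → Coord n → Coord n → ℝ) (i k : Fin n) (x y : Coord n) : ℝ :=
  2 * pdx k (G i) x y - spr G (pdy k (G i)) x y - ∑ j, pdy j (G i) x y * pdy k (G j) x y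

/-- The Riemann curvature of a metric depends on the metric only through its spray. -/
theorem riemannCurv_eq_sprayCurv (L : Coord n → Coord n → ℝ) (i k : Fin n) :
    riemannCurv L i k x y = sprayCurv (geodesicCoeff L) i k x y := by
  simp only [riemannCurv, sprayCurv, spr, Finset.sum_sub_distrib, ← Finset.mul_sum]
  ring

theorem spr_congr {G : Fin n → Coord n → Coord n → ℝ} (hΩ : IsOpen Ω) (h : (x, y) ∈ Ω)
    (hfg : ∀ x y, (x, y) ∈ Ω → f x y = g x y) : spr G f x y = spr G g x y := by
  unfold spr
  refine Finset.sum_congr rfl fun j _ => ?_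
  rw [pdx_congr hΩ h hfg, pdy_congr hΩ h hfg]

/-- The curvature of a spray depends only on the germ of its coefficients. -/
theorem sprayCurv_congr {G H : Fin n → Coord n → Coord n → ℝ} (hΩ : IsOpen Ω) (h : (x, y) ∈ Ω)
    (hGH : ∀ i x y, (x, y) ∈ Ω → G i x y = H i x y) (i k : Fin n) :
    sprayCurv G i k x y = sprayCurv H i k x y := by
  have e : ∀ j, pdy j (G i) x y = pdy j (H i) x y := fun j => pdy_congr hΩ h (hGH i) j
  have e' : ∀ j, pdy k (G j) x y = pdy k (H j) x y := fun j => pdy_congr hΩ h (hGH j) k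
  have e2 : spr G (pdy k (G i)) x y = spr H (pdy k (H i)) x y := by
    rw [spr_congr hΩ h (fun x y hxy => pdy_congr hΩ hxy (hGH i) k)]
    simp only [spr, hGH _ x y h]
  simp only [sprayCurv, pdx_congr hΩ h (hGH i) k, e, e', e2]

variable {G : Fin n → Coord n → Coord n → ℝ}

theorem SmoothOn.spr (hf : SmoothOn Ω f) (hG : ∀ i, SmoothOn Ω (G i)) (hΩ : IsOpen Ω) :
    SmoothOn Ω (spr G f) :=
  .sum fun j _ => ((SmoothOn.vel j).mul (hf.pdx hΩ j)).sub
    ((SmoothOn.const 2).mul ((hG j).mul (hf.pdy hΩ j)))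

theorem spr_add (hf : SmoothOn Ω f) (hg : SmoothOn Ω g) (hΩ : IsOpen Ω) (h : (x, y) ∈ Ω) :
    spr G (fun x y => f x y + g x y) x y = spr G f x y + spr G g x y := by
  simp only [spr, pdx_add hf hg hΩ h, pdy_add hf hg hΩ h, ← Finset.sum_add_distrib]
  exact Finset.sum_congr rfl fun _ _ => by ring

theorem spr_sub (hf : SmoothOn Ω f) (hg : SmoothOn Ω g) (hΩ : IsOpen Ω) (h : (x, y) ∈ Ω) :
    spr G (fun x y => f x y - g x y) x y = spr G f x y - spr G g x y := by
  simp only [spr, pdx_sub hf hg hΩ h, pdy_sub hf hg hΩ h, ← Finset.sum_sub_distrib]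
  exact Finset.sum_congr rfl fun _ _ => by ring

theorem spr_mul (hf : SmoothOn Ω f) (hg : SmoothOn Ω g) (hΩ : IsOpen Ω) (h : (x, y) ∈ Ω) :
    spr G (fun x y => f x y * g x y) x y = spr G f x y * g x y + f x y * spr G g x y := by
  simp only [spr, pdx_mul hf hg hΩ h, pdy_mul hf hg hΩ h, Finset.sum_mul, Finset.mul_sum,
    ← Finset.sum_add_distrib]
  exact Finset.sum_congr rfl fun _ _ => by ring

theorem spr_sum {ι : Type*} {s : Finset ι} {f : ι → Coord n → Coord n → ℝ}
    (hf : ∀ i ∈ s, SmoothOn Ω (f i)) (hΩ : IsOpen Ω) (h : (x, y) ∈ Ω) :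
    spr G (fun x y => ∑ i ∈ s, f i x y) x y = ∑ i ∈ s, spr G (f i) x y := by
  simp only [spr, pdx_sum hf hΩ h, pdy_sum hf hΩ h, Finset.mul_sum, ← Finset.sum_sub_distrib]
  exact Finset.sum_comm

theorem pdx_vel (i k : Fin n) : pdx k (fun _ y => y i) x y = 0 := pd_const _ k

theorem pdy_vel (i k : Fin n) : pdy k (fun _ y => y i) x y = kron i k := pd_vel i k

theorem pdx_const (c : ℝ) (k : Fin n) : pdx k (fun _ _ => c) x y = 0 := pd_const _ k

theorem pdy_const (c : ℝ) (k : Fin n) : pdy k (fun _ _ => c) x y = 0 := pd_const _ k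

theorem pdx_pos (c : Coord n → ℝ) (k : Fin n) : pdx k (fun x _ => c x) x y = pd k c x := rfl

theorem pdy_pos (c : Coord n → ℝ) (k : Fin n) : pdy k (fun x _ => c x) x y = 0 := pd_const _ k

theorem sum_mul_kron (f : Fin n → ℝ) (i : Fin n) : ∑ j, f j * kron i j = f i := by
  simp [kron]

theorem sum_mul_kron' (f : Fin n → ℝ) (i : Fin n) : ∑ j, f j * kron j i = f i := by
  simp [kron]

/-- The commutator of `∂/∂x^k` with a spray. -/
theorem pdx_spr (hf : SmoothOn Ω f) (hG : ∀ i, SmoothOn Ω (G i)) (hΩ : IsOpen Ω)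
    (h : (x, y) ∈ Ω) (k : Fin n) :
    pdx k (spr G f) x y = spr G (pdx k f) x y - 2 * ∑ l, pdx k (G l) x y * pdy l f x y := by
  unfold spr
  have h1 (j) : SmoothOn Ω (fun x y => y j * pdx j f x y) := (SmoothOn.vel j).mul (hf.pdx hΩ j)
  have h2 (j) : SmoothOn Ω (fun x y => G j x y * pdy j f x y) := (hG j).mul (hf.pdy hΩ j)
  rw [pdx_sum (fun j _ => (h1 j).sub ((SmoothOn.const 2).mul (h2 j))) hΩ h, Finset.mul_sum,
    ← Finset.sum_sub_distrib]
  refine Finset.sum_congr rfl fun j _ => ?_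
  rw [pdx_sub (h1 j) ((SmoothOn.const 2).mul (h2 j)) hΩ h, pdx_mul (.const 2) (h2 j) hΩ h,
    pdx_mul (.vel j) (hf.pdx hΩ j) hΩ h, pdx_mul (hG j) (hf.pdy hΩ j) hΩ h, pdx_vel, pdx_const,
    pdx_pdx_comm hf hΩ h, pdx_pdy_comm hf hΩ h]
  ring

/-- The commutator of `∂/∂y^m` with a spray. -/
theorem pdy_spr (hf : SmoothOn Ω f) (hG : ∀ i, SmoothOn Ω (G i)) (hΩ : IsOpen Ω)
    (h : (x, y) ∈ Ω) (m : Fin n) :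
    pdy m (spr G f) x y =
      spr G (pdy m f) x y + pdx m f x y - 2 * ∑ l, pdy m (G l) x y * pdy l f x y := by
  unfold spr
  have h1 (j) : SmoothOn Ω (fun x y => y j * pdx j f x y) := (SmoothOn.vel j).mul (hf.pdx hΩ j)
  have h2 (j) : SmoothOn Ω (fun x y => G j x y * pdy j f x y) := (hG j).mul (hf.pdy hΩ j)
  rw [pdy_sum (fun j _ => (h1 j).sub ((SmoothOn.const 2).mul (h2 j))) hΩ h, Finset.mul_sum,
    ← sum_mul_kron' (fun j => pdx j f x y) m, ← Finset.sum_add_distrib, ← Finset.sum_sub_distrib]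
  refine Finset.sum_congr rfl fun j _ => ?_
  rw [pdy_sub (h1 j) ((SmoothOn.const 2).mul (h2 j)) hΩ h, pdy_mul (.const 2) (h2 j) hΩ h,
    pdy_mul (.vel j) (hf.pdx hΩ j) hΩ h, pdy_mul (hG j) (hf.pdy hΩ j) hΩ h, pdy_vel, pdy_const,
    pdx_pdy_comm hf hΩ h, pdy_pdy_comm hf hΩ h]
  ring

/-- The Euler-Lagrange equation of a function `L` that is horizontally constant for a spray. -/
theorem spr_pdy_of_horizontal {L : Coord n → Coord n → ℝ} (hL : SmoothOn Ω L)
    (hG : ∀ i, SmoothOn Ω (G i)) (hΩ : IsOpen Ω)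
    (hhor : ∀ x y, (x, y) ∈ Ω → ∀ k, pdx k L x y = ∑ i, pdy k (G i) x y * pdy i L x y)
    (hspr : ∀ x y, (x, y) ∈ Ω → spr G L x y = 0) (h : (x, y) ∈ Ω) (m : Fin n) :
    spr G (pdy m L) x y = pdx m L x y := by
  have h1 := pdy_spr hL hG hΩ h m
  rw [pdy_congr (g := fun _ _ => 0) hΩ h hspr, pdy_const, ← hhor x y h m] at h1
  linarith

/-- If a function `L` on the tangent bundle is horizontally constant for a spray, its vertical
Hessian makes the Riemann curvature of the spray self-adjoint. -/
theorem sprayCurv_selfAdjoint {L : Coord n → Coord n → ℝ} (hL : SmoothOn Ω L)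
    (hG : ∀ i, SmoothOn Ω (G i)) (hΩ : IsOpen Ω)
    (hhor : ∀ x y, (x, y) ∈ Ω → ∀ k, pdx k L x y = ∑ i, pdy k (G i) x y * pdy i L x y)
    (hspr : ∀ x y, (x, y) ∈ Ω → spr G L x y = 0) (h : (x, y) ∈ Ω) (k m : Fin n) :
    ∑ i, pdy i (pdy m L) x y * sprayCurv G i k x y =
      ∑ i, pdy i (pdy k L) x y * sprayCurv G i m x y := by
  have e1 := fun m x y h => spr_pdy_of_horizontal (x := x) (y := y) hL hG hΩ hhor hspr h m
  have e2 : ∀ k m, spr G (pdx k (pdy m L)) x y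
      = pdx k (pdx m L) x y + 2 * ∑ l, pdx k (G l) x y * pdy l (pdy m L) x y := by
    intro k m
    have h1 := pdx_spr (hL.pdy hΩ m) hG hΩ h k
    rw [pdx_congr hΩ h (e1 m)] at h1
    linarith
  have hc : ∀ k m x y, (x, y) ∈ Ω → pdx k (pdy m L) x y =
      ∑ l, (pdy m (pdy k (G l)) x y * pdy l L x y + pdy k (G l) x y * pdy l (pdy m L) x y) := by
    intro k m x y h
    rw [pdx_pdy_comm hL hΩ h, pdy_congr hΩ h (fun x y hxy => hhor x y hxy k),
      pdy_sum (fun l _ => ((hG l).pdy hΩ k).mul (hL.pdy hΩ l)) hΩ h]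
    refine Finset.sum_congr rfl fun l _ => ?_
    rw [pdy_mul ((hG l).pdy hΩ k) (hL.pdy hΩ l) hΩ h, pdy_pdy_comm hL hΩ h m l]
  -- The vertical Hessian is covariantly constant along the spray.
  have e3 : ∀ m i, spr G (pdy i (pdy m L)) x y =
      ∑ l, pdy i (G l) x y * pdy l (pdy m L) x y
        + ∑ l, pdy m (G l) x y * pdy l (pdy i L) x y := by
    intro m i
    have h1 := pdy_spr (hL.pdy hΩ m) hG hΩ h i
    rw [pdy_congr hΩ h (e1 m), ← pdx_pdy_comm hL hΩ h, hc m i x y h, hc i m x y h,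
      Finset.sum_add_distrib, Finset.sum_add_distrib] at h1
    simp only [pdy_pdy_comm (hG _) hΩ h m i] at h1
    linarith
  have hs1 (k m l) : SmoothOn Ω (fun x y => pdy m (pdy k (G l)) x y * pdy l L x y) :=
    (((hG l).pdy hΩ k).pdy hΩ m).mul (hL.pdy hΩ l)
  have hs2 (k m l) : SmoothOn Ω (fun x y => pdy k (G l) x y * pdy l (pdy m L) x y) :=
    ((hG l).pdy hΩ k).mul ((hL.pdy hΩ m).pdy hΩ l)
  have e4 : ∀ k m, spr G (pdx k (pdy m L)) x y =
      ∑ l, spr G (fun x y => pdy m (pdy k (G l)) x y * pdy l L x y) x y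
      + ∑ l, (spr G (pdy k (G l)) x y * pdy l (pdy m L) x y
        + pdy k (G l) x y * spr G (pdy l (pdy m L)) x y) := by
    intro k m
    rw [spr_congr hΩ h (hc k m), spr_sum (fun l _ => (hs1 k m l).add (hs2 k m l)) hΩ h,
      ← Finset.sum_add_distrib]
    refine Finset.sum_congr rfl fun l _ => ?_
    rw [spr_add (hs1 k m l) (hs2 k m l) hΩ h,
      spr_mul ((hG l).pdy hΩ k) ((hL.pdy hΩ m).pdy hΩ l) hΩ h]
  -- Up to commuting partial derivatives, the right-hand side is symmetric in `k` and `m`.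
  have key : ∀ k m, ∑ i, pdy i (pdy m L) x y * sprayCurv G i k x y =
      ∑ l, spr G (fun x y => pdy m (pdy k (G l)) x y * pdy l L x y) x y - pdx k (pdx m L) x y
      + ∑ l, ∑ i, pdy k (G l) x y * pdy m (G i) x y * pdy i (pdy l L) x y := by
    intro k m
    have h1 := e4 k m
    rw [e2 k m] at h1
    simp only [e3, mul_add, Finset.sum_add_distrib, Finset.mul_sum] at h1
    simp only [sprayCurv, mul_sub, Finset.sum_sub_distrib, Finset.mul_sum]
    rw [Finset.sum_comm (f := fun i l => pdy i (pdy m L) x y *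
      (pdy l (G i) x y * pdy k (G l) x y))]
    have h2 : ∀ i l, pdy i (pdy m L) x y * (pdy l (G i) x y * pdy k (G l) x y)
        = pdy k (G l) x y * (pdy l (G i) x y * pdy i (pdy m L) x y) := fun _ _ => by ring
    have h3 : ∀ i l, pdy k (G l) x y * (pdy m (G i) x y * pdy i (pdy l L) x y)
        = pdy k (G l) x y * pdy m (G i) x y * pdy i (pdy l L) x y := fun _ _ => by ring
    have h4 : ∀ i, pdy i (pdy m L) x y * (2 * pdx k (G i) x y)
        = 2 * (pdx k (G i) x y * pdy i (pdy m L) x y) := fun _ => by ring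
    have h5 : ∀ i, pdy i (pdy m L) x y * spr G (pdy k (G i)) x y
        = spr G (pdy k (G i)) x y * pdy i (pdy m L) x y := fun _ => by ring
    simp only [h2, h4, h5]
    simp only [h3] at h1
    linarith
  have hcongr : ∀ l, spr G (fun x y => pdy m (pdy k (G l)) x y * pdy l L x y) x y
      = spr G (fun x y => pdy k (pdy m (G l)) x y * pdy l L x y) x y := fun l =>
    spr_congr hΩ h fun x y hxy => by rw [pdy_pdy_comm (hG l) hΩ hxy]
  rw [key k m, key m k, pdx_pdx_comm hL hΩ h k m, Finset.sum_congr rfl fun l _ => hcongr l,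
    Finset.sum_comm (f := fun l i => pdy k (G l) x y * pdy m (G i) x y * pdy i (pdy l L) x y)]
  congr 1
  refine Finset.sum_congr rfl fun i _ => Finset.sum_congr rfl fun l _ => ?_
  rw [pdy_pdy_comm hL hΩ h i l]
  ring

/-- A homogeneous spray for which `L = F²` is horizontally constant is the geodesic spray
of `F`. -/
theorem geodesicCoeff_eq_of_horizontal {F : Coord n → Coord n → ℝ}
    (hL : SmoothOn Ω (fun x y => F x y ^ 2)) (hG : ∀ i, SmoothOn Ω (G i)) (hΩ : IsOpen Ω)
    (hhor : ∀ x y, (x, y) ∈ Ω → ∀ k, pdx k (fun x y => F x y ^ 2) x y =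
      ∑ i, pdy k (G i) x y * pdy i (fun x y => F x y ^ 2) x y)
    (hspr : ∀ x y, (x, y) ∈ Ω → spr G (fun x y => F x y ^ 2) x y = 0)
    (hEuler : ∀ x y, (x, y) ∈ Ω → ∑ j, pdy j (fun x y => F x y ^ 2) x y * y j = 2 * F x y ^ 2)
    (h : (x, y) ∈ Ω) (hdet : IsUnit (fundTensor F x y)) (i : Fin n) :
    geodesicCoeff F i x y = G i x y := by
  set L : Coord n → Coord n → ℝ := fun x y => F x y ^ 2 with hLdef
  have hE1 : ∀ l x y, (x, y) ∈ Ω → ∑ j, pdy l (pdy j L) x y * y j = pdy l L x y := by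
    intro l x y h
    have h1 := pdy_congr (g := fun x y => 2 * L x y) hΩ h hEuler l
    rw [pdy_sum (fun j _ => (hL.pdy hΩ j).mul (.vel j)) hΩ h, pdy_mul (.const 2) hL hΩ h,
      pdy_const] at h1
    simp only [pdy_mul (hL.pdy hΩ _) (.vel _) hΩ h, pdy_vel, Finset.sum_add_distrib,
      sum_mul_kron'] at h1
    linarith
  have hE2 : ∀ k l, ∑ j, pdx k (pdy l (pdy j L)) x y * y j = pdx k (pdy l L) x y := by
    intro k l
    have h1 := pdx_congr (g := pdy l L) hΩ h (hE1 l) k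
    rw [pdx_sum (fun j _ => ((hL.pdy hΩ j).pdy hΩ l).mul (.vel j)) hΩ h] at h1
    simpa only [pdx_mul ((hL.pdy hΩ _).pdy hΩ _) (.vel _) hΩ h, pdx_vel, mul_zero,
      add_zero] using h1
  have hE3 : ∀ l, ∑ k, pdx l (pdy k L) x y * y k = 2 * pdx l L x y := by
    intro l
    have h1 := pdx_congr (g := fun x y => 2 * L x y) hΩ h hEuler l
    rw [pdx_sum (fun j _ => (hL.pdy hΩ j).mul (.vel j)) hΩ h, pdx_mul (.const 2) hL hΩ h,
      pdx_const] at h1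
    simp only [pdx_mul (hL.pdy hΩ _) (.vel _) hΩ h, pdx_vel, mul_zero, zero_mul, add_zero,
      zero_add] at h1
    exact h1
  have hg : ∀ k i j, pdx k (fun x y => fundTensor F x y i j) x y =
      1 / 2 * pdx k (pdy j (pdy i L)) x y := by
    intro k i j
    have : (fun x y => fundTensor F x y i j) = fun x y => 1 / 2 * pdy j (pdy i L) x y := rfl
    rw [this, pdx_mul (.const (1 / 2)) ((hL.pdy hΩ _).pdy hΩ _) hΩ h, pdx_const]
    ring
  have hrhs : ∀ l, ∑ j, ∑ k, (2 * pdx k (fun x y => fundTensor F x y j l) x y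
      - pdx l (fun x y => fundTensor F x y j k) x y) * y j * y k =
      4 * ∑ m, fundTensor F x y l m * G m x y := by
    intro l
    have h1 := spr_pdy_of_horizontal hL hG hΩ hhor hspr h l
    have h2 :
        ∑ j, ∑ k, pdx k (pdy l (pdy j L)) x y * y j * y k = ∑ k, y k * pdx k (pdy l L) x y := by
      rw [Finset.sum_comm]
      simp only [← Finset.sum_mul, hE2]
      exact Finset.sum_congr rfl fun _ _ => mul_comm _ _
    have h3 : ∑ j, ∑ k, pdx l (pdy k (pdy j L)) x y * y j * y k = 2 * pdx l L x y := by
      rw [Finset.sum_comm, ← hE3 l]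
      simp only [← Finset.sum_mul, hE2]
    have h4 : ∑ m, fundTensor F x y l m * G m x y = 1 / 2 * ∑ j, G j x y * pdy j (pdy l L) x y := by
      rw [Finset.mul_sum]
      refine Finset.sum_congr rfl fun m _ => ?_
      simp only [fundTensor, Matrix.of_apply]
      ring
    have h5 : ∑ j, ∑ k, (2 * pdx k (fun x y => fundTensor F x y j l) x y
        - pdx l (fun x y => fundTensor F x y j k) x y) * y j * y k =
        ∑ j, ∑ k, pdx k (pdy l (pdy j L)) x y * y j * y k
          - 1 / 2 * ∑ j, ∑ k, pdx l (pdy k (pdy j L)) x y * y j * y k := by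
      simp only [hg, Finset.mul_sum, ← Finset.sum_sub_distrib]
      exact Finset.sum_congr rfl fun _ _ => Finset.sum_congr rfl fun _ _ => by ring
    rw [h5, h2, h3, h4]
    simp only [spr, Finset.sum_sub_distrib, ← Finset.mul_sum] at h1
    linarith
  have hinv : (fundTensor F x y)⁻¹.mulVec ((fundTensor F x y).mulVec fun m => G m x y) =
      fun m => G m x y := by
    rw [Matrix.mulVec_mulVec, Matrix.nonsing_inv_mul _ ((Matrix.isUnit_iff_isUnit_det _).1 hdet),
      Matrix.one_mulVec]
  have := congrFun hinv i
  rw [← this]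
  simp only [geodesicCoeff, hrhs, Matrix.mulVec, dotProduct, Finset.mul_sum]
  exact Finset.sum_congr rfl fun _ _ => Finset.sum_congr rfl fun _ _ => by ring

/-- The Riemann curvature of a homogeneous spray annihilates the direction of the flagpole. -/
theorem sprayCurv_y (hG : ∀ i, SmoothOn Ω (G i)) (hΩ : IsOpen Ω)
    (hEuler : ∀ i x y, (x, y) ∈ Ω → ∑ k, pdy k (G i) x y * y k = 2 * G i x y)
    (h : (x, y) ∈ Ω) (i : Fin n) : ∑ k, sprayCurv G i k x y * y k = 0 := by
  have hv : ∀ k, spr G (fun _ y => y k) x y = -2 * G k x y := by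
    intro k
    have e : ∀ j, 2 * (G j x y * kron k j) = (2 * G j x y) * kron k j := fun _ => by ring
    simp only [spr, pdx_vel, pdy_vel, e, mul_zero, zero_sub, Finset.sum_neg_distrib]
    simp [kron]
  have h1 := spr_congr (G := G) (g := fun x y => 2 * G i x y) hΩ h (hEuler i)
  rw [spr_sum (fun k _ => ((hG i).pdy hΩ k).mul (.vel k)) hΩ h,
    spr_mul (.const 2) (hG i) hΩ h] at h1
  simp only [spr_mul ((hG i).pdy hΩ _) (.vel _) hΩ h, hv, Finset.sum_add_distrib] at h1
  have h2 : spr G (fun _ _ => 2) x y = 0 := by simp [spr, pdx_const, pdy_const]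
  have h3 : spr G (G i) x y = ∑ k, pdx k (G i) x y * y k - 2 * ∑ k, pdy k (G i) x y * G k x y := by
    simp only [spr, Finset.mul_sum, ← Finset.sum_sub_distrib]
    exact Finset.sum_congr rfl fun _ _ => by ring
  have h4 : ∑ k, (∑ j, pdy j (G i) x y * pdy k (G j) x y) * y k =
      2 * ∑ j, pdy j (G i) x y * G j x y := by
    simp only [Finset.sum_mul, Finset.mul_sum]
    rw [Finset.sum_comm]
    refine Finset.sum_congr rfl fun j _ => ?_
    rw [mul_left_comm, ← hEuler j x y h, Finset.mul_sum]
    exact Finset.sum_congr rfl fun _ _ => by ring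
  have h5 : ∑ k, pdy k (G i) x y * (-2 * G k x y) = -2 * ∑ j, pdy j (G i) x y * G j x y := by
    rw [Finset.mul_sum]
    exact Finset.sum_congr rfl fun _ _ => by ring
  have h6 : ∑ k, sprayCurv G i k x y * y k = 2 * ∑ k, pdx k (G i) x y * y k
      - ∑ k, spr G (pdy k (G i)) x y * y k
      - ∑ k, (∑ j, pdy j (G i) x y * pdy k (G j) x y) * y k := by
    rw [Finset.mul_sum, ← Finset.sum_sub_distrib, ← Finset.sum_sub_distrib]
    refine Finset.sum_congr rfl fun k _ => ?_
    simp only [sprayCurv]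
    ring
  rw [h2, h3, h5] at h1
  rw [h6, h4]
  linarith

/-- The Riemann curvature of a sum of a spray and a deviation tensor. -/
theorem sprayCurv_add {H : Fin n → Coord n → Coord n → ℝ} (hG : ∀ i, SmoothOn Ω (G i))
    (hH : ∀ i, SmoothOn Ω (H i)) (hΩ : IsOpen Ω) (h : (x, y) ∈ Ω) (i k : Fin n) :
    sprayCurv (fun i x y => G i x y + H i x y) i k x y = sprayCurv G i k x y
      + 2 * pdx k (H i) x y - spr G (pdy k (H i)) x y
      + 2 * ∑ j, H j x y * pdy j (pdy k (G i)) x y + 2 * ∑ j, H j x y * pdy j (pdy k (H i)) x y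
      - ∑ j, pdy j (G i) x y * pdy k (H j) x y - ∑ j, pdy j (H i) x y * pdy k (G j) x y
      - ∑ j, pdy j (H i) x y * pdy k (H j) x y := by
  have e1 : spr (fun i x y => G i x y + H i x y) (pdy k fun x y => G i x y + H i x y) x y =
      spr G (pdy k (G i)) x y + spr G (pdy k (H i)) x y
        - 2 * ∑ j, H j x y * pdy j (pdy k (G i)) x y
        - 2 * ∑ j, H j x y * pdy j (pdy k (H i)) x y := by
    rw [spr_congr hΩ h (g := fun x y => pdy k (G i) x y + pdy k (H i) x y)
      (fun x y hxy => pdy_add (hG i) (hH i) hΩ hxy k),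
      spr_add ((hG i).pdy hΩ k) ((hH i).pdy hΩ k) hΩ h]
    simp only [spr, Finset.mul_sum, ← Finset.sum_sub_distrib, ← Finset.sum_add_distrib]
    exact Finset.sum_congr rfl fun _ _ => by ring
  have e2 : ∑ j, pdy j (fun x y => G i x y + H i x y) x y * pdy k (fun x y => G j x y + H j x y) x y
      = ∑ j, pdy j (G i) x y * pdy k (G j) x y + ∑ j, pdy j (G i) x y * pdy k (H j) x y
        + ∑ j, pdy j (H i) x y * pdy k (G j) x y + ∑ j, pdy j (H i) x y * pdy k (H j) x y := by
    simp only [pdy_add (hG _) (hH _) hΩ h, ← Finset.sum_add_distrib]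
    exact Finset.sum_congr rfl fun _ _ => by ring
  simp only [sprayCurv, e1, e2, pdx_add (hG i) (hH i) hΩ h]
  ring

end Calculus

/-! ### Local Randers data -/

section LocalData

variable {n : ℕ}

/-- The value `β(y) = b_i(x) y^i` of a 1-form. -/
def betaForm (b : Coord n → Fin n → ℝ) (x y : Coord n) : ℝ := ∑ i, b x i * y i

/-- The metric `α`, in terms of its components. -/
def alphaFun (a : Coord n → Matrix (Fin n) (Fin n) ℝ) (x y : Coord n) : ℝ := √(alphaSq a x y)

/-- The Randers function `α + β` of the components of a metric and a 1-form. -/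
def randers (a : Coord n → Matrix (Fin n) (Fin n) ℝ) (b : Coord n → Fin n → ℝ)
    (x y : Coord n) : ℝ := alphaFun a x y + betaForm b x y

/-- The components `a_ij`, `b_i` over an open coordinate domain `U` define a Randers metric. -/
structure IsRandersPair (U : Set (Coord n)) (a : Coord n → Matrix (Fin n) (Fin n) ℝ)
    (b : Coord n → Fin n → ℝ) : Prop where
  isOpen : IsOpen U
  smooth_a : ∀ i j, ContDiffOn ℝ ∞ (fun x => a x i j) U
  smooth_b : ∀ i, ContDiffOn ℝ ∞ (fun x => b x i) U
  symm : ∀ x i j, a x i j = a x j i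
  pos : ∀ x ∈ U, ∀ y : Coord n, y ≠ 0 → 0 < alphaSq a x y
  abs_lt : ∀ x ∈ U, ∀ y : Coord n, y ≠ 0 → |betaForm b x y| < alphaFun a x y

/-- The tangent bundle over `U` without its zero section. -/
def slit (U : Set (Coord n)) : Set (Coord n × Coord n) := U ×ˢ {0}ᶜ

/-- The Levi-Civita connection `N^i_k = Γ^i_kj y^j`. -/
def conn (a : Coord n → Matrix (Fin n) (Fin n) ℝ) (i k : Fin n) (x y : Coord n) : ℝ :=
  ∑ j, christoffel a i k j x * y j

/-- The spray coefficients `(1/2) Γ^i_jk y^j y^k` of a Riemannian metric. -/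
def leviSpray (a : Coord n → Matrix (Fin n) (Fin n) ℝ) (i : Fin n) (x y : Coord n) : ℝ :=
  (1 / 2) * ∑ k, conn a i k x y * y k

variable {U : Set (Coord n)} {a : Coord n → Matrix (Fin n) (Fin n) ℝ}
  {b : Coord n → Fin n → ℝ} {x y : Coord n}

theorem contDiffOn_pd {f : Coord n → ℝ} (hf : ContDiffOn ℝ ∞ f U) (hU : IsOpen U) (k : Fin n) :
    ContDiffOn ℝ ∞ (pd k f) U :=
  (hf.fderiv_of_isOpen hU (m := ∞) (by simp)).clm_apply contDiffOn_const

theorem contDiffOn_det {m : ℕ} {A : Coord n → Matrix (Fin m) (Fin m) ℝ}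
    (hA : ∀ i j, ContDiffOn ℝ ∞ (fun x => A x i j) U) :
    ContDiffOn ℝ ∞ (fun x => (A x).det) U := by
  simp only [Matrix.det_apply']
  exact ContDiffOn.sum fun σ _ => contDiffOn_const.mul (contDiffOn_prod fun i _ => hA _ _)

theorem alphaSq_eq_sum_yLow (a : Coord n → Matrix (Fin n) (Fin n) ℝ) (x y : Coord n) :
    alphaSq a x y = ∑ k, yLow a k x y * y k := by
  simp only [alphaSq, yLow, Finset.sum_mul]
  rw [Finset.sum_comm]

theorem isUnit_of_mulVec_eq_zero {A : Matrix (Fin n) (Fin n) ℝ}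
    (h : ∀ v, A.mulVec v = 0 → v = 0) : IsUnit A :=
  Matrix.mulVec_injective_iff_isUnit.1 ((injective_iff_map_eq_zero A.mulVecLin).2 h)

namespace IsRandersPair

theorem isOpen_slit (D : IsRandersPair U a b) : IsOpen (slit U) :=
  D.isOpen.prod isOpen_compl_singleton

theorem isUnit_a (D : IsRandersPair U a b) (hx : x ∈ U) : IsUnit (a x) := by
  refine isUnit_of_mulVec_eq_zero fun v hv => ?_
  by_contra hne
  have h := D.pos x hx (WithLp.toLp 2 v) (by simpa using hne)
  have h0 : alphaSq a x (WithLp.toLp 2 v) = ∑ i, v i * (a x).mulVec v i := by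
    simp only [alphaSq, Matrix.mulVec, dotProduct, Finset.mul_sum]
    exact Finset.sum_congr rfl fun _ _ => Finset.sum_congr rfl fun _ _ => by ring
  simp [h0, hv] at h

theorem sum_a_inv (D : IsRandersPair U a b) (hx : x ∈ U) (i j : Fin n) :
    ∑ l, a x i l * (a x)⁻¹ l j = kron i j := by
  have := Matrix.mul_nonsing_inv _ ((Matrix.isUnit_iff_isUnit_det _).1 (D.isUnit_a hx))
  simpa [Matrix.mul_apply, Matrix.one_apply, kron] using congrFun (congrFun this i) j

theorem inv_symm (D : IsRandersPair U a b) (x : Coord n) (i j : Fin n) :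
    (a x)⁻¹ i j = (a x)⁻¹ j i := by
  have h : (a x).transpose = a x := by ext i j; exact D.symm x j i
  have := Matrix.transpose_nonsing_inv (a x)
  rw [h] at this
  exact congrFun (congrFun this j) i

theorem smooth_inv (D : IsRandersPair U a b) (i j : Fin n) :
    ContDiffOn ℝ ∞ (fun x => (a x)⁻¹ i j) U := by
  have h : ∀ x ∈ U, (a x)⁻¹ i j = (a x).adjugate i j / (a x).det := by
    intro x hx
    rw [Matrix.inv_def]
    simp [Ring.inverse_eq_inv', div_eq_inv_mul]
  refine ContDiffOn.congr ?_ h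
  refine ContDiffOn.div ?_ (contDiffOn_det D.smooth_a) fun x hx =>
    ((Matrix.isUnit_iff_isUnit_det _).1 (D.isUnit_a hx)).ne_zero
  simp only [Matrix.adjugate_apply]
  refine contDiffOn_det fun p q => ?_
  simp only [Matrix.updateRow_apply]
  split_ifs
  · exact contDiffOn_const
  · exact D.smooth_a p q

theorem smooth_christoffel (D : IsRandersPair U a b) (k i j : Fin n) :
    ContDiffOn ℝ ∞ (christoffel a k i j) U :=
  contDiffOn_const.mul <| ContDiffOn.sum fun l _ => (D.smooth_inv k l).mul
    (((contDiffOn_pd (D.smooth_a j l) D.isOpen i).add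
      (contDiffOn_pd (D.smooth_a i l) D.isOpen j)).sub
      (contDiffOn_pd (D.smooth_a i j) D.isOpen l))

theorem christoffel_symm (D : IsRandersPair U a b) (k i j : Fin n) (x : Coord n) :
    christoffel a k i j x = christoffel a k j i x := by
  have : (fun x => a x i j) = fun x => a x j i := funext fun x => D.symm x i j
  simp only [christoffel, this]
  exact congrArg _ (Finset.sum_congr rfl fun _ _ => by ring)

theorem lower_christoffel (D : IsRandersPair U a b) (hx : x ∈ U) (m i j : Fin n) :
    ∑ k, a x m k * christoffel a k i j x = (1 / 2) *
      (pd i (fun x => a x j m) x + pd j (fun x => a x i m) x - pd m (fun x => a x i j) x) := by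
  have : ∀ k, a x m k * christoffel a k i j x = ∑ l, a x m k * (a x)⁻¹ k l * ((1 / 2) *
      (pd i (fun x => a x j l) x + pd j (fun x => a x i l) x - pd l (fun x => a x i j) x)) := by
    intro k
    simp only [christoffel, Finset.mul_sum]
    exact Finset.sum_congr rfl fun _ _ => by ring
  simp only [this]
  rw [Finset.sum_comm]
  simp only [← Finset.sum_mul, D.sum_a_inv hx]
  simp [kron]

/-- The Levi-Civita connection is metric. -/
theorem pd_a (D : IsRandersPair U a b) (hx : x ∈ U) (k i j : Fin n) :
    pd k (fun x => a x i j) x =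
      ∑ l, a x i l * christoffel a l k j x + ∑ l, a x j l * christoffel a l k i x := by
  rw [D.lower_christoffel hx, D.lower_christoffel hx]
  have e : ∀ i j, (fun x => a x i j) = fun x => a x j i := fun i j => funext fun x => D.symm x i j
  rw [e j i]
  ring

theorem smooth_covOne (D : IsRandersPair U a b) {w : Coord n → Fin n → ℝ}
    (hw : ∀ i, ContDiffOn ℝ ∞ (fun x => w x i) U) (i j : Fin n) :
    ContDiffOn ℝ ∞ (covOne a w i j) U :=
  (contDiffOn_pd (hw i) D.isOpen j).sub
    (ContDiffOn.sum fun k _ => (D.smooth_christoffel k i j).mul (hw k))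

theorem smooth_sLow (D : IsRandersPair U a b) (i j : Fin n) :
    ContDiffOn ℝ ∞ (fun x => sLow a b x i j) U :=
  ((D.smooth_covOne D.smooth_b i j).sub (D.smooth_covOne D.smooth_b j i)).div_const 2

theorem smooth_sUp (D : IsRandersPair U a b) (i j : Fin n) :
    ContDiffOn ℝ ∞ (fun x => sUp a b x i j) U :=
  ContDiffOn.sum fun k _ => (D.smooth_inv i k).mul (D.smooth_sLow k j)

theorem smooth_sVec (D : IsRandersPair U a b) (j : Fin n) :
    ContDiffOn ℝ ∞ (fun x => sVec a b x j) U :=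
  ContDiffOn.sum fun i _ => (D.smooth_b i).mul (D.smooth_sUp i j)

theorem sLow_antisymm (i j : Fin n) : sLow a b x i j = -sLow a b x j i := by
  simp only [sLow]; ring

theorem lower_sUp (D : IsRandersPair U a b) (hx : x ∈ U) (i j : Fin n) :
    ∑ k, a x i k * sUp a b x k j = sLow a b x i j := by
  simp only [sUp, Finset.mul_sum, ← mul_assoc]
  rw [Finset.sum_comm]
  simp only [← Finset.sum_mul, D.sum_a_inv hx]
  simp [kron]

theorem trace_sUp (D : IsRandersPair U a b) (x : Coord n) : ∑ i, sUp a b x i i = 0 := by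
  have h : ∑ i, sUp a b x i i = -∑ i, sUp a b x i i := by
    conv_lhs => simp only [sUp]
    rw [Finset.sum_comm, ← Finset.sum_neg_distrib]
    refine Finset.sum_congr rfl fun i _ => ?_
    simp only [sUp, ← Finset.sum_neg_distrib]
    refine Finset.sum_congr rfl fun k _ => ?_
    rw [D.inv_symm x k i, sLow_antisymm i k]
    ring
  linarith

/-- The endomorphism `s^i_j` is skew with respect to the Riemannian metric. -/
theorem yLow_sUp (D : IsRandersPair U a b) (hx : x ∈ U) (k : Fin n) :
    ∑ i, yLow a i x y * sUp a b x i k = -sLow_0 a b k x y := by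
  simp only [yLow, Finset.sum_mul, sLow_0, ← Finset.sum_neg_distrib]
  rw [Finset.sum_comm]
  refine Finset.sum_congr rfl fun j _ => ?_
  rw [← D.lower_sUp hx k j, D.lower_sUp hx, sLow_antisymm k j, ← D.lower_sUp hx j k]
  simp only [neg_mul, neg_neg, Finset.sum_mul]
  exact Finset.sum_congr rfl fun _ _ => by ring

theorem sLow_0_y : ∑ k, sLow_0 a b k x y * y k = 0 := by
  have h : ∑ k, sLow_0 a b k x y * y k = -∑ k, sLow_0 a b k x y * y k := by
    simp only [sLow_0, Finset.sum_mul]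
    conv_lhs => rw [Finset.sum_comm]
    simp only [← Finset.sum_neg_distrib]
    refine Finset.sum_congr rfl fun i _ => Finset.sum_congr rfl fun j _ => ?_
    rw [sLow_antisymm j i]
    ring
  linarith

theorem yLow_sUp_0 (D : IsRandersPair U a b) (hx : x ∈ U) :
    ∑ i, yLow a i x y * sUp_0 a b i x y = 0 := by
  have : ∑ i, yLow a i x y * sUp_0 a b i x y =
      ∑ k, (∑ i, yLow a i x y * sUp a b x i k) * y k := by
    simp only [sUp_0, Finset.mul_sum, Finset.sum_mul]
    rw [Finset.sum_comm]
    exact Finset.sum_congr rfl fun _ _ => Finset.sum_congr rfl fun _ _ => by ring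
  simp only [this, D.yLow_sUp hx, neg_mul, Finset.sum_neg_distrib, sLow_0_y, neg_zero]

theorem b_sUp_0 : ∑ i, b x i * sUp_0 a b i x y = s_0 a b x y := by
  simp only [sUp_0, s_0, sVec, Finset.mul_sum, Finset.sum_mul]
  rw [Finset.sum_comm]
  exact Finset.sum_congr rfl fun _ _ => Finset.sum_congr rfl fun _ _ => by ring

theorem lower_sUp_0 (D : IsRandersPair U a b) (hx : x ∈ U) (k : Fin n) :
    ∑ i, a x i k * sUp_0 a b i x y = sLow_0 a b k x y := by
  simp only [sUp_0, Finset.mul_sum, sLow_0]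
  rw [Finset.sum_comm]
  refine Finset.sum_congr rfl fun p _ => ?_
  rw [← D.lower_sUp hx k p, Finset.sum_mul]
  refine Finset.sum_congr rfl fun i _ => ?_
  rw [D.symm x i k]
  ring

end IsRandersPair

end LocalData

/-! ### Derivatives of the contracted tensors -/

section Contractions

variable {n : ℕ} {U : Set (Coord n)} {a : Coord n → Matrix (Fin n) (Fin n) ℝ}
  {b : Coord n → Fin n → ℝ} {x y : Coord n}

/-- The vertical derivative `∂α/∂y^k = y_k / α`. -/
def alphaDer (a : Coord n → Matrix (Fin n) (Fin n) ℝ) (k : Fin n) (x y : Coord n) : ℝ :=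
  yLow a k x y / alphaFun a x y

theorem SmoothOn.mono {Ω Ω' : Set (Coord n × Coord n)} {f : Coord n → Coord n → ℝ}
    (hf : SmoothOn Ω f) (h : Ω' ⊆ Ω) : SmoothOn Ω' f :=
  ContDiffOn.mono hf h

theorem slit_subset : slit U ⊆ U ×ˢ Set.univ := Set.prod_mono le_rfl (Set.subset_univ _)

theorem SmoothOn.position_full {c : Coord n → ℝ} (hc : ContDiffOn ℝ ∞ c U) :
    SmoothOn (U ×ˢ Set.univ) (fun x _ => c x) :=
  .position hc fun _ hz => hz.1

/-- A function `c_p(x) y^p`, linear in the velocity, is smooth. -/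
theorem SmoothOn.lin {c : Coord n → Fin n → ℝ} (hc : ∀ p, ContDiffOn ℝ ∞ (fun x => c x p) U) :
    SmoothOn (U ×ˢ Set.univ) (fun x y => ∑ p, c x p * y p) :=
  .sum fun p _ => (SmoothOn.position_full (hc p)).mul (.vel p)

theorem pdx_lin {c : Coord n → Fin n → ℝ} (hc : ∀ p, ContDiffOn ℝ ∞ (fun x => c x p) U)
    (hU : IsOpen U) (hx : x ∈ U) (k : Fin n) :
    pdx k (fun x y => ∑ p, c x p * y p) x y = ∑ p, pd k (fun x => c x p) x * y p := by
  have hΩ : IsOpen (U ×ˢ (Set.univ : Set (Coord n))) := hU.prod isOpen_univ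
  have h : (x, y) ∈ U ×ˢ (Set.univ : Set (Coord n)) := ⟨hx, trivial⟩
  rw [pdx_sum (fun p _ => (SmoothOn.position_full (hc p)).mul (.vel p)) hΩ h]
  simp only [pdx_mul (SmoothOn.position_full (hc _)) (.vel _) hΩ h, pdx_vel, pdx_pos, mul_zero,
    add_zero]

theorem pdy_lin (c : Coord n → Fin n → ℝ) (k : Fin n) :
    pdy k (fun x y => ∑ p, c x p * y p) x y = c x k := by
  have h (p : Fin n) : SmoothOn Set.univ (fun _ y : Coord n => c x p * y p) :=
    (SmoothOn.const _).mul (.vel p)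
  have := pdy_sum (s := Finset.univ) (fun p _ => h p) isOpen_univ
    (Set.mem_univ (x, y)) k
  simp only [pdy_mul (.const _) (.vel _) isOpen_univ (Set.mem_univ (x, y)), pdy_vel, pdy_const,
    zero_mul, zero_add, sum_mul_kron'] at this
  exact this

/-- The horizontal derivative of a function on the tangent bundle along a Riemannian spray is
the contraction of its horizontal covariant derivative. -/
theorem spr_leviSpray (f : Coord n → Coord n → ℝ) :
    spr (leviSpray a) f x y =
      ∑ j, y j * (pdx j f x y - ∑ l, pdy l f x y * conn a l j x y) := by
  simp only [spr, leviSpray, mul_sub, Finset.sum_sub_distrib, Finset.mul_sum, Finset.sum_mul]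
  congr 1
  rw [Finset.sum_comm]
  exact Finset.sum_congr rfl fun _ _ => Finset.sum_congr rfl fun _ _ => by ring

namespace IsRandersPair

theorem isOpen_full (D : IsRandersPair U a b) : IsOpen (U ×ˢ (Set.univ : Set (Coord n))) :=
  D.isOpen.prod isOpen_univ

theorem smooth_conn (D : IsRandersPair U a b) (i k : Fin n) :
    SmoothOn (U ×ˢ Set.univ) (conn a i k) :=
  .lin (c := fun x j => christoffel a i k j x) fun j => D.smooth_christoffel i k j

theorem pdy_conn (i k j : Fin n) : pdy j (conn a i k) x y = christoffel a i k j x :=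
  pdy_lin (fun x j => christoffel a i k j x) j

theorem smooth_leviSpray (D : IsRandersPair U a b) (i : Fin n) :
    SmoothOn (U ×ˢ Set.univ) (leviSpray a i) :=
  (SmoothOn.const _).mul (.sum fun k _ => (D.smooth_conn i k).mul (.vel k))

theorem pdy_leviSpray (D : IsRandersPair U a b) (hx : x ∈ U) (i k : Fin n) :
    pdy k (leviSpray a i) x y = conn a i k x y := by
  have h : (x, y) ∈ U ×ˢ (Set.univ : Set (Coord n)) := ⟨hx, trivial⟩
  have h1 : SmoothOn (U ×ˢ Set.univ) (fun x y => ∑ k, conn a i k x y * y k) :=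
    .sum fun k _ => (D.smooth_conn i k).mul (.vel k)
  have := pdy_mul (.const (1 / 2)) h1 D.isOpen_full h k
  simp only [pdy_const, pdy_sum (fun k _ => (D.smooth_conn i k).mul (.vel k)) D.isOpen_full h,
    pdy_mul (D.smooth_conn i _) (.vel _) D.isOpen_full h, pdy_vel, pdy_conn,
    Finset.sum_add_distrib, sum_mul_kron'] at this
  have e : ∑ j, christoffel a i j k x * y j = conn a i k x y :=
    Finset.sum_congr rfl fun j _ => by rw [D.christoffel_symm]
  rw [e] at this
  refine this.trans ?_
  ring

/-- The derivative of `w_p y^p`, for a covector field `w`. -/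
theorem pdx_covector (D : IsRandersPair U a b) {w : Coord n → Fin n → ℝ}
    (hw : ∀ p, ContDiffOn ℝ ∞ (fun x => w x p) U) (hx : x ∈ U) (k : Fin n) :
    pdx k (fun x y => ∑ p, w x p * y p) x y =
      ∑ p, covOne a w p k x * y p + ∑ l, w x l * conn a l k x y := by
  rw [pdx_lin hw D.isOpen hx]
  have : ∑ l, w x l * conn a l k x y = ∑ p, (∑ l, christoffel a l p k x * w x l) * y p := by
    simp only [conn, Finset.mul_sum, Finset.sum_mul]
    rw [Finset.sum_comm]
    refine Finset.sum_congr rfl fun p _ => Finset.sum_congr rfl fun l _ => ?_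
    rw [D.christoffel_symm l p k]
    ring
  rw [this, ← Finset.sum_add_distrib]
  refine Finset.sum_congr rfl fun p _ => ?_
  simp only [covOne]
  ring

theorem spr_covector (D : IsRandersPair U a b) {w : Coord n → Fin n → ℝ}
    (hw : ∀ p, ContDiffOn ℝ ∞ (fun x => w x p) U) (hx : x ∈ U) :
    spr (leviSpray a) (fun x y => ∑ p, w x p * y p) x y =
      ∑ p, ∑ q, covOne a w p q x * y p * y q := by
  rw [spr_leviSpray]
  simp only [D.pdx_covector hw hx, pdy_lin, add_sub_cancel_right]
  rw [Finset.sum_comm]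
  simp only [Finset.mul_sum]
  exact Finset.sum_congr rfl fun _ _ => Finset.sum_congr rfl fun _ _ => by ring

theorem spr_covector_component (w : Coord n → Fin n → ℝ) (k : Fin n) :
    spr (leviSpray a) (fun x _ => w x k) x y =
      ∑ p, covOne a w k p x * y p + ∑ l, conn a l k x y * w x l := by
  rw [spr_leviSpray]
  have : ∑ l, conn a l k x y * w x l = ∑ p, (∑ l, christoffel a l k p x * w x l) * y p := by
    simp only [conn, Finset.sum_mul]
    rw [Finset.sum_comm]
    exact Finset.sum_congr rfl fun p _ => Finset.sum_congr rfl fun l _ => by ring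
  rw [this, ← Finset.sum_add_distrib]
  refine Finset.sum_congr rfl fun p _ => ?_
  simp only [covOne, pdy_pos, pdx_pos, zero_mul, Finset.sum_const_zero]
  ring

/-- The derivative of `T^i_p y^p`, for a tensor field `T^i_j`. -/
theorem pdx_mixed (D : IsRandersPair U a b) {T : Coord n → Fin n → Fin n → ℝ} {i : Fin n}
    (hT : ∀ p, ContDiffOn ℝ ∞ (fun x => T x i p) U) (hx : x ∈ U) (k : Fin n) :
    pdx k (fun x y => ∑ p, T x i p * y p) x y =
      ∑ p, covMixed a T i p k x * y p - ∑ l, christoffel a i k l x * ∑ p, T x l p * y p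
        + ∑ l, T x i l * conn a l k x y := by
  rw [pdx_lin hT D.isOpen hx]
  have e1 : ∑ l, T x i l * conn a l k x y = ∑ p, (∑ l, christoffel a l k p x * T x i l) * y p := by
    simp only [conn, Finset.mul_sum, Finset.sum_mul]
    rw [Finset.sum_comm]
    exact Finset.sum_congr rfl fun p _ => Finset.sum_congr rfl fun l _ => by ring
  have e2 : ∑ l, christoffel a i k l x * ∑ p, T x l p * y p =
      ∑ p, (∑ l, christoffel a i k l x * T x l p) * y p := by
    simp only [Finset.mul_sum, Finset.sum_mul]
    rw [Finset.sum_comm]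
    exact Finset.sum_congr rfl fun p _ => Finset.sum_congr rfl fun l _ => by ring
  rw [e1, e2, ← Finset.sum_sub_distrib, ← Finset.sum_add_distrib]
  refine Finset.sum_congr rfl fun p _ => ?_
  simp only [covMixed]
  ring

theorem spr_mixed (D : IsRandersPair U a b) {T : Coord n → Fin n → Fin n → ℝ} {i : Fin n}
    (hT : ∀ p, ContDiffOn ℝ ∞ (fun x => T x i p) U) (hx : x ∈ U) :
    spr (leviSpray a) (fun x y => ∑ p, T x i p * y p) x y =
      ∑ p, ∑ q, covMixed a T i p q x * y p * y q
        - ∑ l, conn a i l x y * ∑ p, T x l p * y p := by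
  rw [spr_leviSpray]
  simp only [D.pdx_mixed hT hx, pdy_lin (fun x p => T x i p), add_sub_cancel_right, mul_sub,
    Finset.sum_sub_distrib]
  congr 1
  · rw [Finset.sum_comm]
    simp only [Finset.mul_sum]
    exact Finset.sum_congr rfl fun _ _ => Finset.sum_congr rfl fun _ _ => by ring
  · simp only [conn, Finset.mul_sum, Finset.sum_mul]
    rw [Finset.sum_comm]
    refine Finset.sum_congr rfl fun l _ => ?_
    rw [Finset.sum_comm]
    refine Finset.sum_congr rfl fun p _ => Finset.sum_congr rfl fun j _ => ?_
    rw [D.christoffel_symm i j l]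
    ring

theorem spr_mixed_component (D : IsRandersPair U a b) (T : Coord n → Fin n → Fin n → ℝ)
    (i k : Fin n) :
    spr (leviSpray a) (fun x _ => T x i k) x y =
      ∑ p, covMixed a T i k p x * y p - ∑ l, conn a i l x y * T x l k
        + ∑ l, conn a l k x y * T x i l := by
  rw [spr_leviSpray]
  have e1 : ∑ l, conn a l k x y * T x i l = ∑ p, (∑ l, christoffel a l p k x * T x i l) * y p := by
    simp only [conn, Finset.sum_mul]
    rw [Finset.sum_comm]
    refine Finset.sum_congr rfl fun p _ => Finset.sum_congr rfl fun l _ => ?_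
    rw [D.christoffel_symm l p k]
    ring
  have e2 : ∑ l, conn a i l x y * T x l k = ∑ p, (∑ l, christoffel a i p l x * T x l k) * y p := by
    simp only [conn, Finset.sum_mul]
    rw [Finset.sum_comm]
    refine Finset.sum_congr rfl fun p _ => Finset.sum_congr rfl fun l _ => ?_
    rw [D.christoffel_symm i p l]
    ring
  rw [e1, e2, ← Finset.sum_sub_distrib, ← Finset.sum_add_distrib]
  refine Finset.sum_congr rfl fun p _ => ?_
  simp only [covMixed, pdy_pos, pdx_pos, zero_mul, Finset.sum_const_zero]
  ring

theorem smooth_yLow (D : IsRandersPair U a b) (k : Fin n) :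
    SmoothOn (U ×ˢ Set.univ) (yLow a k) :=
  .lin (c := fun x j => a x j k) fun j => D.smooth_a j k

theorem pdy_yLow (k j : Fin n) : pdy j (yLow a k) x y = a x j k :=
  pdy_lin (fun x j => a x j k) j

/-- The derivative of `y_m = a_jm y^j`: both Christoffel terms of the metric identity appear. -/
theorem pdx_yLow (D : IsRandersPair U a b) (hx : x ∈ U) (m k : Fin n) :
    pdx k (yLow a m) x y =
      ∑ l, a x l m * conn a l k x y + ∑ l, yLow a l x y * christoffel a l k m x := by
  have h := pdx_lin (y := y) (c := fun x j => a x j m) (fun j => D.smooth_a j m) D.isOpen hx k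
  refine h.trans ?_
  have e1 : ∑ l, a x l m * conn a l k x y =
      ∑ p, (∑ l, a x m l * christoffel a l k p x) * y p := by
    simp only [conn, Finset.mul_sum, Finset.sum_mul]
    rw [Finset.sum_comm]
    refine Finset.sum_congr rfl fun p _ => Finset.sum_congr rfl fun l _ => ?_
    rw [D.symm x l m]
    ring
  have e2 : ∑ l, yLow a l x y * christoffel a l k m x =
      ∑ p, (∑ l, a x p l * christoffel a l k m x) * y p := by
    simp only [yLow, Finset.sum_mul]
    rw [Finset.sum_comm]
    exact Finset.sum_congr rfl fun p _ => Finset.sum_congr rfl fun l _ => by ring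
  rw [e1, e2, ← Finset.sum_add_distrib]
  refine Finset.sum_congr rfl fun p _ => ?_
  rw [D.pd_a hx]
  ring

theorem spr_yLow (D : IsRandersPair U a b) (hx : x ∈ U) (m : Fin n) :
    spr (leviSpray a) (yLow a m) x y = ∑ l, conn a l m x y * yLow a l x y := by
  rw [spr_leviSpray]
  simp only [D.pdx_yLow hx, pdy_yLow, add_sub_cancel_left]
  simp only [conn, Finset.mul_sum, Finset.sum_mul]
  rw [Finset.sum_comm]
  refine Finset.sum_congr rfl fun p _ => Finset.sum_congr rfl fun l _ => ?_
  rw [D.christoffel_symm p l m]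
  ring

theorem smooth_alphaSq (D : IsRandersPair U a b) : SmoothOn (U ×ˢ Set.univ) (alphaSq a) := by
  have : alphaSq a = fun x y => ∑ k, yLow a k x y * y k := by
    ext x y; exact alphaSq_eq_sum_yLow a x y
  rw [this]
  exact .sum fun k _ => (D.smooth_yLow k).mul (.vel k)

theorem pdy_alphaSq (D : IsRandersPair U a b) (hx : x ∈ U) (k : Fin n) :
    pdy k (alphaSq a) x y = 2 * yLow a k x y := by
  have h : (x, y) ∈ U ×ˢ (Set.univ : Set (Coord n)) := ⟨hx, trivial⟩
  have : alphaSq a = fun x y => ∑ k, yLow a k x y * y k := by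
    ext x y; exact alphaSq_eq_sum_yLow a x y
  rw [this, pdy_sum (fun k _ => (D.smooth_yLow k).mul (.vel k)) D.isOpen_full h]
  simp only [pdy_mul (D.smooth_yLow _) (.vel _) D.isOpen_full h, pdy_vel, pdy_yLow,
    Finset.sum_add_distrib, sum_mul_kron']
  have : ∑ j, a x k j * y j = yLow a k x y := Finset.sum_congr rfl fun j _ => by rw [D.symm]
  rw [this]
  ring

theorem pdx_alphaSq (D : IsRandersPair U a b) (hx : x ∈ U) (k : Fin n) :
    pdx k (alphaSq a) x y = 2 * ∑ l, yLow a l x y * conn a l k x y := by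
  have h : (x, y) ∈ U ×ˢ (Set.univ : Set (Coord n)) := ⟨hx, trivial⟩
  have : alphaSq a = fun x y => ∑ k, yLow a k x y * y k := by
    ext x y; exact alphaSq_eq_sum_yLow a x y
  rw [this, pdx_sum (fun k _ => (D.smooth_yLow k).mul (.vel k)) D.isOpen_full h]
  simp only [pdx_mul (D.smooth_yLow _) (.vel _) D.isOpen_full h, pdx_vel, D.pdx_yLow hx,
    mul_zero, add_zero, add_mul, Finset.sum_add_distrib]
  have e1 : ∑ m, (∑ l, a x l m * conn a l k x y) * y m = ∑ l, yLow a l x y * conn a l k x y := by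
    simp only [yLow, Finset.sum_mul]
    rw [Finset.sum_comm]
    refine Finset.sum_congr rfl fun l _ => Finset.sum_congr rfl fun m _ => ?_
    rw [D.symm x l m]
    ring
  have e2 : ∑ m, (∑ l, yLow a l x y * christoffel a l k m x) * y m =
      ∑ l, yLow a l x y * conn a l k x y := by
    simp only [conn, Finset.sum_mul, Finset.mul_sum]
    rw [Finset.sum_comm]
    exact Finset.sum_congr rfl fun l _ => Finset.sum_congr rfl fun m _ => by ring
  rw [e1, e2]
  ring

theorem alphaSq_pos (D : IsRandersPair U a b) (h : (x, y) ∈ slit U) : 0 < alphaSq a x y :=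
  D.pos x h.1 y h.2

theorem alphaFun_pos (D : IsRandersPair U a b) (h : (x, y) ∈ slit U) : 0 < alphaFun a x y :=
  Real.sqrt_pos.2 (D.alphaSq_pos h)

theorem alphaFun_sq (D : IsRandersPair U a b) (h : (x, y) ∈ slit U) :
    alphaFun a x y ^ 2 = alphaSq a x y :=
  Real.sq_sqrt (D.alphaSq_pos h).le

theorem alphaDer_mul (D : IsRandersPair U a b) (h : (x, y) ∈ slit U) (k : Fin n) :
    alphaFun a x y * alphaDer a k x y = yLow a k x y :=
  mul_div_cancel₀ _ (D.alphaFun_pos h).ne'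

theorem smooth_alphaFun (D : IsRandersPair U a b) : SmoothOn (slit U) (alphaFun a) :=
  (D.smooth_alphaSq.mono slit_subset).sqrt fun _ hz => (D.alphaSq_pos hz).ne'

theorem smooth_alphaDer (D : IsRandersPair U a b) (k : Fin n) :
    SmoothOn (slit U) (alphaDer a k) :=
  ((D.smooth_yLow k).mono slit_subset).div D.smooth_alphaFun fun _ hz => (D.alphaFun_pos hz).ne'

theorem pdy_alphaFun (D : IsRandersPair U a b) (h : (x, y) ∈ slit U) (k : Fin n) :
    pdy k (alphaFun a) x y = alphaDer a k x y := by
  refine (pdy_sqrt (D.smooth_alphaSq.mono slit_subset) D.isOpen_slit h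
    (D.alphaSq_pos h).ne' k).trans ?_
  rw [D.pdy_alphaSq h.1]
  exact mul_div_mul_left _ _ two_ne_zero

theorem pdx_alphaFun (D : IsRandersPair U a b) (h : (x, y) ∈ slit U) (k : Fin n) :
    pdx k (alphaFun a) x y = ∑ l, alphaDer a l x y * conn a l k x y := by
  refine (pdx_sqrt (D.smooth_alphaSq.mono slit_subset) D.isOpen_slit h
    (D.alphaSq_pos h).ne' k).trans ?_
  rw [D.pdx_alphaSq h.1, mul_div_mul_left _ _ two_ne_zero, Finset.sum_div]
  refine Finset.sum_congr rfl fun l _ => ?_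
  simp only [alphaDer, alphaFun]
  ring

theorem spr_alphaFun (D : IsRandersPair U a b) (h : (x, y) ∈ slit U) :
    spr (leviSpray a) (alphaFun a) x y = 0 := by
  rw [spr_leviSpray]
  simp only [D.pdx_alphaFun h, D.pdy_alphaFun h, sub_self, mul_zero, Finset.sum_const_zero]

theorem pdy_alphaDer (D : IsRandersPair U a b) (h : (x, y) ∈ slit U) (j k : Fin n) :
    alphaFun a x y * pdy j (alphaDer a k) x y =
      a x j k - alphaDer a j x y * alphaDer a k x y := by
  have h1 := pdy_congr (g := yLow a k) D.isOpen_slit h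
    (fun x y hxy => D.alphaDer_mul hxy k) j
  rw [pdy_mul D.smooth_alphaFun (D.smooth_alphaDer k) D.isOpen_slit h, pdy_yLow,
    D.pdy_alphaFun h] at h1
  linarith

theorem spr_alphaDer (D : IsRandersPair U a b) (h : (x, y) ∈ slit U) (k : Fin n) :
    spr (leviSpray a) (alphaDer a k) x y = ∑ l, conn a l k x y * alphaDer a l x y := by
  have h1 := spr_congr (G := leviSpray a) (g := yLow a k) D.isOpen_slit h
    (fun x y hxy => D.alphaDer_mul hxy k)
  rw [spr_mul D.smooth_alphaFun (D.smooth_alphaDer k) D.isOpen_slit h, D.spr_yLow h.1,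
    D.spr_alphaFun h, zero_mul, zero_add] at h1
  have h2 : ∑ l, conn a l k x y * yLow a l x y =
      alphaFun a x y * ∑ l, conn a l k x y * alphaDer a l x y := by
    rw [Finset.mul_sum]
    refine Finset.sum_congr rfl fun l _ => ?_
    rw [← D.alphaDer_mul h]
    ring
  rw [h2] at h1
  exact mul_left_cancel₀ (D.alphaFun_pos h).ne' h1

theorem alphaDer_y (D : IsRandersPair U a b) (h : (x, y) ∈ slit U) :
    ∑ k, alphaDer a k x y * y k = alphaFun a x y := by
  have : ∑ k, alphaDer a k x y * y k = alphaSq a x y / alphaFun a x y := by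
    rw [alphaSq_eq_sum_yLow, Finset.sum_div]
    exact Finset.sum_congr rfl fun k _ => by simp only [alphaDer]; ring
  rw [this, ← D.alphaFun_sq h, sq, mul_div_assoc, div_self (D.alphaFun_pos h).ne', mul_one]

theorem alphaDer_sUp (D : IsRandersPair U a b) (h : (x, y) ∈ slit U) (k : Fin n) :
    alphaFun a x y * ∑ i, alphaDer a i x y * sUp a b x i k = -sLow_0 a b k x y := by
  rw [← D.yLow_sUp h.1, Finset.mul_sum]
  refine Finset.sum_congr rfl fun i _ => ?_
  rw [← D.alphaDer_mul h]
  ring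

theorem alphaDer_sUp_0 (D : IsRandersPair U a b) (h : (x, y) ∈ slit U) :
    ∑ i, alphaDer a i x y * sUp_0 a b i x y = 0 := by
  have h1 := D.yLow_sUp_0 (y := y) h.1
  have h2 : ∑ i, yLow a i x y * sUp_0 a b i x y =
      alphaFun a x y * ∑ i, alphaDer a i x y * sUp_0 a b i x y := by
    rw [Finset.mul_sum]
    refine Finset.sum_congr rfl fun i _ => ?_
    rw [← D.alphaDer_mul h]
    ring
  rw [h2] at h1
  exact (mul_eq_zero.1 h1).resolve_left (D.alphaFun_pos h).ne'

end IsRandersPair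

end Contractions

/-! ### The spray of a Randers metric -/

section Spray

variable {n : ℕ} {U : Set (Coord n)} {a : Coord n → Matrix (Fin n) (Fin n) ℝ}
  {b : Coord n → Fin n → ℝ} {x y : Coord n}

theorem pdx_sq {Ω : Set (Coord n × Coord n)} {f : Coord n → Coord n → ℝ} (hf : SmoothOn Ω f)
    (hΩ : IsOpen Ω) (h : (x, y) ∈ Ω) (k : Fin n) :
    pdx k (fun x y => f x y ^ 2) x y = 2 * f x y * pdx k f x y := by
  simp only [sq]
  rw [pdx_mul hf hf hΩ h]
  ring

theorem pdy_sq {Ω : Set (Coord n × Coord n)} {f : Coord n → Coord n → ℝ} (hf : SmoothOn Ω f)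
    (hΩ : IsOpen Ω) (h : (x, y) ∈ Ω) (k : Fin n) :
    pdy k (fun x y => f x y ^ 2) x y = 2 * f x y * pdy k f x y := by
  simp only [sq]
  rw [pdy_mul hf hf hΩ h]
  ring

/-- The vertical derivative `∂F/∂y^k = y_k / α + b_k` of `F = α + β`. -/
def randersDer (a : Coord n → Matrix (Fin n) (Fin n) ℝ) (b : Coord n → Fin n → ℝ) (k : Fin n)
    (x y : Coord n) : ℝ := alphaDer a k x y + b x k

/-- The quadratic form `e_00 = b_{i|j} y^i y^j + 2 s_0 β`. -/
def eForm (a : Coord n → Matrix (Fin n) (Fin n) ℝ) (b : Coord n → Fin n → ℝ)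
    (x y : Coord n) : ℝ :=
  ∑ i, (∑ j, covOne a b i j x * y j) * y i + 2 * (s_0 a b x y * betaForm b x y)

/-- The linear form `e_k0`, one half of the vertical derivative of `e_00`. -/
def eDer (a : Coord n → Matrix (Fin n) (Fin n) ℝ) (b : Coord n → Fin n → ℝ) (k : Fin n)
    (x y : Coord n) : ℝ :=
  (1 / 2) * (∑ j, covOne a b k j x * y j + ∑ j, covOne a b j k x * y j)
    + sVec a b x k * betaForm b x y + s_0 a b x y * b x k

/-- The factor `e_00 / (2F)` in the spray of a Randers metric. -/
def eFactor (a : Coord n → Matrix (Fin n) (Fin n) ℝ) (b : Coord n → Fin n → ℝ)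
    (x y : Coord n) : ℝ := eForm a b x y / (2 * randers a b x y)

/-- The spray coefficients `G^i + (e_00 / (2F) - s_0) y^i + α s^i_0` of `F = α + β`, where the
`G^i` are those of `α`. -/
def randersSpray (a : Coord n → Matrix (Fin n) (Fin n) ℝ) (b : Coord n → Fin n → ℝ) (i : Fin n)
    (x y : Coord n) : ℝ :=
  leviSpray a i x y +
    ((eFactor a b x y - s_0 a b x y) * y i + alphaFun a x y * sUp_0 a b i x y)

theorem pdy_betaForm (k : Fin n) : pdy k (betaForm b) x y = b x k :=
  pdy_lin b k

theorem pdy_s_0 (k : Fin n) : pdy k (s_0 a b) x y = sVec a b x k :=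
  pdy_lin (sVec a b) k

theorem pdy_sUp_0 (i k : Fin n) : pdy k (sUp_0 a b i) x y = sUp a b x i k :=
  pdy_lin (fun x p => sUp a b x i p) k

theorem alphaSq_eq_alphaSq_add (hsymm : ∀ i j, a x i j = a x j i) (u : Coord n) (c : ℝ) :
    alphaSq a x (u - c • y) =
      alphaSq a x u - 2 * c * ∑ k, yLow a k x y * u k + c ^ 2 * alphaSq a x y := by
  have h : ∑ i, ∑ j, a x i j * u i * y j = ∑ i, ∑ j, a x i j * y i * u j := by
    rw [Finset.sum_comm]
    refine Finset.sum_congr rfl fun i _ => Finset.sum_congr rfl fun j _ => ?_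
    rw [hsymm j i]
    ring
  have h' : ∑ k, yLow a k x y * u k = ∑ i, ∑ j, a x i j * y i * u j := by
    simp only [yLow, Finset.sum_mul]
    rw [Finset.sum_comm]
  have e : alphaSq a x (u - c • y) = ∑ i, ∑ j, a x i j * u i * u j
      - c * ∑ i, ∑ j, a x i j * u i * y j - c * ∑ i, ∑ j, a x i j * y i * u j
      + c ^ 2 * ∑ i, ∑ j, a x i j * y i * y j := by
    simp only [alphaSq, Finset.mul_sum, ← Finset.sum_sub_distrib, ← Finset.sum_add_distrib]
    refine Finset.sum_congr rfl fun i _ => Finset.sum_congr rfl fun j _ => ?_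
    simp only [PiLp.sub_apply, PiLp.smul_apply, smul_eq_mul]
    ring
  rw [e, h, h']
  simp only [alphaSq]
  ring

namespace IsRandersPair

theorem smooth_betaForm (D : IsRandersPair U a b) : SmoothOn (U ×ˢ Set.univ) (betaForm b) :=
  .lin D.smooth_b

theorem smooth_s_0 (D : IsRandersPair U a b) : SmoothOn (U ×ˢ Set.univ) (s_0 a b) :=
  .lin D.smooth_sVec

theorem smooth_sUp_0 (D : IsRandersPair U a b) (i : Fin n) :
    SmoothOn (U ×ˢ Set.univ) (sUp_0 a b i) :=
  .lin (D.smooth_sUp i)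

theorem smooth_randers (D : IsRandersPair U a b) : SmoothOn (slit U) (randers a b) :=
  D.smooth_alphaFun.add (D.smooth_betaForm.mono slit_subset)

theorem randers_pos (D : IsRandersPair U a b) (h : (x, y) ∈ slit U) : 0 < randers a b x y := by
  have := (_root_.abs_lt.1 (D.abs_lt x h.1 y h.2)).1
  simp only [randers]
  linarith

theorem pdy_randers (D : IsRandersPair U a b) (h : (x, y) ∈ slit U) (k : Fin n) :
    pdy k (randers a b) x y = randersDer a b k x y := by
  refine (pdy_add D.smooth_alphaFun (D.smooth_betaForm.mono slit_subset) D.isOpen_slit h k).trans ?_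
  rw [D.pdy_alphaFun h, pdy_betaForm]
  rfl

theorem pdx_randers (D : IsRandersPair U a b) (h : (x, y) ∈ slit U) (k : Fin n) :
    pdx k (randers a b) x y = ∑ i, randersDer a b i x y * conn a i k x y
      + ∑ i, covOne a b i k x * y i := by
  refine (pdx_add D.smooth_alphaFun (D.smooth_betaForm.mono slit_subset) D.isOpen_slit h k).trans ?_
  rw [D.pdx_alphaFun h]
  have := D.pdx_covector (y := y) D.smooth_b h.1 k
  unfold betaForm
  rw [this]
  simp only [randersDer, add_mul, Finset.sum_add_distrib]
  ring

theorem randersDer_y (D : IsRandersPair U a b) (h : (x, y) ∈ slit U) :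
    ∑ k, randersDer a b k x y * y k = randers a b x y := by
  simp only [randersDer, add_mul, Finset.sum_add_distrib, D.alphaDer_y h]
  rfl

theorem smooth_covOneLin (D : IsRandersPair U a b) (i : Fin n) :
    SmoothOn (U ×ˢ Set.univ) (fun x y => ∑ j, covOne a b i j x * y j) :=
  .lin (c := fun x j => covOne a b i j x) fun j => D.smooth_covOne D.smooth_b i j

theorem smooth_eForm (D : IsRandersPair U a b) : SmoothOn (U ×ˢ Set.univ) (eForm a b) :=
  (SmoothOn.sum fun i _ => (D.smooth_covOneLin i).mul (.vel i)).add
    ((SmoothOn.const 2).mul (D.smooth_s_0.mul D.smooth_betaForm))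

theorem pdy_eForm (D : IsRandersPair U a b) (hx : x ∈ U) (k : Fin n) :
    pdy k (eForm a b) x y = 2 * eDer a b k x y := by
  have h : (x, y) ∈ U ×ˢ (Set.univ : Set (Coord n)) := ⟨hx, trivial⟩
  have h1 (i) := (D.smooth_covOneLin i).mul (.vel i)
  have e (i) : pdy k (fun x y => ∑ j, covOne a b i j x * y j) x y = covOne a b i k x :=
    pdy_lin (fun x j => covOne a b i j x) k
  refine (pdy_add (.sum fun i _ => h1 i)
    ((SmoothOn.const 2).mul (D.smooth_s_0.mul D.smooth_betaForm)) D.isOpen_full h k).trans ?_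
  rw [pdy_sum (fun i _ => h1 i) D.isOpen_full h,
    pdy_mul (.const 2) (D.smooth_s_0.mul D.smooth_betaForm) D.isOpen_full h,
    pdy_mul D.smooth_s_0 D.smooth_betaForm D.isOpen_full h, pdy_const, pdy_s_0, pdy_betaForm]
  simp only [pdy_mul (D.smooth_covOneLin _) (.vel _) D.isOpen_full h, e, pdy_vel,
    Finset.sum_add_distrib, sum_mul_kron', eDer]
  ring

/-- Euler's identity for the quadratic form `e_00`. -/
theorem eDer_y : ∑ k, eDer a b k x y * y k = eForm a b x y := by
  have e1 :
      ∑ k, (∑ j, covOne a b j k x * y j) * y k = ∑ k, (∑ j, covOne a b k j x * y j) * y k := by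
    simp only [Finset.sum_mul]
    rw [Finset.sum_comm]
    exact Finset.sum_congr rfl fun _ _ => Finset.sum_congr rfl fun _ _ => by ring
  have e2 : ∑ k, eDer a b k x y * y k = (1 / 2) * (∑ k, (∑ j, covOne a b k j x * y j) * y k
      + ∑ k, (∑ j, covOne a b j k x * y j) * y k) + (∑ k, sVec a b x k * y k) * betaForm b x y
      + s_0 a b x y * ∑ k, b x k * y k := by
    rw [← Finset.sum_add_distrib, Finset.mul_sum, Finset.sum_mul, Finset.mul_sum,
      ← Finset.sum_add_distrib, ← Finset.sum_add_distrib]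
    refine Finset.sum_congr rfl fun k _ => ?_
    simp only [eDer]
    ring
  rw [e2, e1]
  simp only [eForm, s_0, betaForm]
  ring

theorem smooth_eFactor (D : IsRandersPair U a b) : SmoothOn (slit U) (eFactor a b) :=
  (D.smooth_eForm.mono slit_subset).div ((SmoothOn.const 2).mul D.smooth_randers) fun _ hz =>
    (mul_pos two_pos (D.randers_pos hz)).ne'

theorem eFactor_mul (D : IsRandersPair U a b) (h : (x, y) ∈ slit U) :
    eFactor a b x y * randers a b x y = 1 / 2 * eForm a b x y := by
  have := (D.randers_pos h).ne'
  simp only [eFactor]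
  field_simp

theorem pdy_eFactor (D : IsRandersPair U a b) (h : (x, y) ∈ slit U) (k : Fin n) :
    pdy k (eFactor a b) x y * randers a b x y =
      eDer a b k x y - eFactor a b x y * randersDer a b k x y := by
  have h1 := pdy_congr (g := fun x y => 1 / 2 * eForm a b x y) D.isOpen_slit h
    (fun x y hxy => D.eFactor_mul hxy) k
  rw [pdy_mul D.smooth_eFactor D.smooth_randers D.isOpen_slit h,
    pdy_mul (.const _) (D.smooth_eForm.mono slit_subset) D.isOpen_slit h, pdy_const,
    D.pdy_randers h, D.pdy_eForm h.1] at h1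
  linarith

theorem smooth_randersSpray (D : IsRandersPair U a b) (i : Fin n) :
    SmoothOn (slit U) (randersSpray a b i) :=
  ((D.smooth_leviSpray i).mono slit_subset).add
    (((D.smooth_eFactor.sub (D.smooth_s_0.mono slit_subset)).mul (.vel i)).add
      (D.smooth_alphaFun.mul ((D.smooth_sUp_0 i).mono slit_subset)))

/-- The nonlinear connection of a Randers metric. -/
theorem pdy_randersSpray (D : IsRandersPair U a b) (h : (x, y) ∈ slit U) (i k : Fin n) :
    pdy k (randersSpray a b i) x y = conn a i k x y
      + (pdy k (eFactor a b) x y - sVec a b x k) * y i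
      + (eFactor a b x y - s_0 a b x y) * kron i k
      + alphaDer a k x y * sUp_0 a b i x y + alphaFun a x y * sUp a b x i k := by
  have h1 := D.smooth_eFactor.sub (D.smooth_s_0.mono slit_subset)
  have h2 := (D.smooth_sUp_0 i).mono slit_subset
  refine (pdy_add ((D.smooth_leviSpray i).mono slit_subset)
    ((h1.mul (.vel i)).add (D.smooth_alphaFun.mul h2)) D.isOpen_slit h k).trans ?_
  rw [D.pdy_leviSpray h.1, pdy_add (h1.mul (.vel i)) (D.smooth_alphaFun.mul h2) D.isOpen_slit h,
    pdy_mul h1 (.vel i) D.isOpen_slit h, pdy_mul D.smooth_alphaFun h2 D.isOpen_slit h,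
    pdy_sub D.smooth_eFactor (D.smooth_s_0.mono slit_subset) D.isOpen_slit h, pdy_s_0, pdy_vel,
    pdy_sUp_0, D.pdy_alphaFun h]
  ring

theorem randersDer_sUp (D : IsRandersPair U a b) (h : (x, y) ∈ slit U) (k : Fin n) :
    alphaFun a x y * ∑ i, randersDer a b i x y * sUp a b x i k =
      alphaFun a x y * sVec a b x k - sLow_0 a b k x y := by
  have := D.alphaDer_sUp h k
  simp only [randersDer, add_mul, Finset.sum_add_distrib, mul_add, this, sVec]
  ring

theorem randersDer_sUp_0 (D : IsRandersPair U a b) (h : (x, y) ∈ slit U) :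
    ∑ i, randersDer a b i x y * sUp_0 a b i x y = s_0 a b x y := by
  simp only [randersDer, add_mul, Finset.sum_add_distrib, D.alphaDer_sUp_0 h, b_sUp_0, zero_add]

/-- `F` is horizontally constant for the Randers spray. -/
theorem pdx_randers_eq (D : IsRandersPair U a b) (h : (x, y) ∈ slit U) (k : Fin n) :
    pdx k (randers a b) x y =
      ∑ i, pdy k (randersSpray a b i) x y * pdy i (randers a b) x y := by
  have e : ∑ i, pdy k (randersSpray a b i) x y * pdy i (randers a b) x y =
      ∑ i, randersDer a b i x y * conn a i k x y
      + (pdy k (eFactor a b) x y - sVec a b x k) * ∑ i, randersDer a b i x y * y i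
      + (eFactor a b x y - s_0 a b x y) * ∑ i, randersDer a b i x y * kron i k
      + alphaDer a k x y * ∑ i, randersDer a b i x y * sUp_0 a b i x y
      + alphaFun a x y * ∑ i, randersDer a b i x y * sUp a b x i k := by
    simp only [D.pdy_randersSpray h, D.pdy_randers h, Finset.mul_sum, ← Finset.sum_add_distrib]
    exact Finset.sum_congr rfl fun _ _ => by ring
  rw [e, D.pdx_randers h, D.randersDer_y h, sum_mul_kron', D.randersDer_sUp_0 h,
    D.randersDer_sUp h, sub_mul, D.pdy_eFactor h]
  have e2 : sLow_0 a b k x y =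
      1 / 2 * (∑ j, covOne a b k j x * y j - ∑ j, covOne a b j k x * y j) := by
    simp only [sLow_0, sLow, ← Finset.sum_sub_distrib, Finset.mul_sum]
    exact Finset.sum_congr rfl fun _ _ => by ring
  rw [e2]
  simp only [eDer, randersDer, randers]
  ring

/-- Euler's identity: `e_00 / (2F)` is homogeneous of degree one in the velocity. -/
theorem eFactor_homogeneous (D : IsRandersPair U a b) (h : (x, y) ∈ slit U) :
    ∑ k, pdy k (eFactor a b) x y * y k = eFactor a b x y := by
  have hF := D.randers_pos h
  have h1 : (∑ k, pdy k (eFactor a b) x y * y k) * randers a b x y =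
      ∑ k, eDer a b k x y * y k - eFactor a b x y * ∑ k, randersDer a b k x y * y k := by
    rw [Finset.sum_mul, Finset.mul_sum, ← Finset.sum_sub_distrib]
    refine Finset.sum_congr rfl fun k _ => ?_
    rw [mul_right_comm, D.pdy_eFactor h]
    ring
  rw [eDer_y, D.randersDer_y h, D.eFactor_mul h] at h1
  have h2 := D.eFactor_mul h
  exact mul_right_cancel₀ hF.ne' (by linarith)

theorem randersSpray_homogeneous (D : IsRandersPair U a b) (h : (x, y) ∈ slit U) (i : Fin n) :
    ∑ k, pdy k (randersSpray a b i) x y * y k = 2 * randersSpray a b i x y := by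
  have e : ∑ k, pdy k (randersSpray a b i) x y * y k = ∑ k, conn a i k x y * y k
      + (∑ k, pdy k (eFactor a b) x y * y k - ∑ k, sVec a b x k * y k) * y i
      + (eFactor a b x y - s_0 a b x y) * ∑ k, y k * kron i k
      + (∑ k, alphaDer a k x y * y k) * sUp_0 a b i x y
      + alphaFun a x y * ∑ k, sUp a b x i k * y k := by
    simp only [D.pdy_randersSpray h, Finset.mul_sum, Finset.sum_mul, ← Finset.sum_sub_distrib,
      ← Finset.sum_add_distrib]
    exact Finset.sum_congr rfl fun _ _ => by ring
  have e' : ∑ k, y k * kron i k = y i := by simp [kron]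
  rw [e, D.eFactor_homogeneous h, D.alphaDer_y h, e']
  simp only [randersSpray, leviSpray, s_0, sUp_0]
  ring

theorem smooth_randers_sq (D : IsRandersPair U a b) :
    SmoothOn (slit U) (fun x y => randers a b x y ^ 2) := by
  simp only [sq]
  exact D.smooth_randers.mul D.smooth_randers

theorem pdx_randers_sq (D : IsRandersPair U a b) (h : (x, y) ∈ slit U) (k : Fin n) :
    pdx k (fun x y => randers a b x y ^ 2) x y =
      ∑ i, pdy k (randersSpray a b i) x y * pdy i (fun x y => randers a b x y ^ 2) x y := by
  rw [pdx_sq D.smooth_randers D.isOpen_slit h, D.pdx_randers_eq h, Finset.mul_sum]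
  refine Finset.sum_congr rfl fun i _ => ?_
  rw [pdy_sq D.smooth_randers D.isOpen_slit h]
  ring

theorem spr_randers_sq (D : IsRandersPair U a b) (h : (x, y) ∈ slit U) :
    spr (randersSpray a b) (fun x y => randers a b x y ^ 2) x y = 0 := by
  have e : ∀ j, 2 * (randersSpray a b j x y * pdy j (fun x y => randers a b x y ^ 2) x y) =
      ∑ k, y k * (pdy k (randersSpray a b j) x y * pdy j (fun x y => randers a b x y ^ 2) x y) := by
    intro j
    rw [← mul_assoc, ← D.randersSpray_homogeneous h, Finset.sum_mul]
    exact Finset.sum_congr rfl fun _ _ => by ring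
  simp only [spr, D.pdx_randers_sq h, e, Finset.mul_sum, Finset.sum_sub_distrib]
  rw [Finset.sum_comm, sub_self]

theorem euler_randers_sq (D : IsRandersPair U a b) (h : (x, y) ∈ slit U) :
    ∑ j, pdy j (fun x y => randers a b x y ^ 2) x y * y j = 2 * randers a b x y ^ 2 := by
  have : ∑ j, pdy j (fun x y => randers a b x y ^ 2) x y * y j =
      2 * randers a b x y * ∑ j, randersDer a b j x y * y j := by
    rw [Finset.mul_sum]
    refine Finset.sum_congr rfl fun j _ => ?_
    rw [pdy_sq D.smooth_randers D.isOpen_slit h, D.pdy_randers h]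
    ring
  rw [this, D.randersDer_y h]
  ring

/-! ### The fundamental tensor of a Randers metric -/

/-- The fundamental tensor `l_i l_j + (F/α) (a_ij - α_i α_j)`, where `l_i = ∂F/∂y^i` and
`α_i = ∂α/∂y^i`, multiplied by `α` to clear the denominator. -/
theorem fundTensor_randers (D : IsRandersPair U a b) (h : (x, y) ∈ slit U) (i j : Fin n) :
    alphaFun a x y * fundTensor (randers a b) x y i j =
      alphaFun a x y * (randersDer a b i x y * randersDer a b j x y)
      + randers a b x y * (a x i j - alphaDer a i x y * alphaDer a j x y) := by
  have hb : SmoothOn (slit U) (fun x _ => b x i) :=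
    .position (D.smooth_b i) fun _ hz => hz.1
  have hd : SmoothOn (slit U) (randersDer a b i) := (D.smooth_alphaDer i).add hb
  have h1 : pdy j (pdy i (fun x y => randers a b x y ^ 2)) x y =
      2 * (randersDer a b j x y * randersDer a b i x y
        + randers a b x y * pdy j (alphaDer a i) x y) := by
    rw [pdy_congr (g := fun x y => 2 * (randers a b x y * randersDer a b i x y)) D.isOpen_slit h
      (fun x y hxy => by
        rw [pdy_sq D.smooth_randers D.isOpen_slit hxy, D.pdy_randers hxy, mul_assoc]),
      pdy_mul (.const 2) (D.smooth_randers.mul hd) D.isOpen_slit h,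
      pdy_mul D.smooth_randers hd D.isOpen_slit h, pdy_const, D.pdy_randers h]
    have : pdy j (randersDer a b i) x y = pdy j (alphaDer a i) x y := by
      refine (pdy_add (D.smooth_alphaDer i) hb D.isOpen_slit h j).trans ?_
      rw [pdy_pos, add_zero]
    rw [this]
    ring
  have h2 := D.pdy_alphaDer h j i
  simp only [fundTensor, Matrix.of_apply, h1]
  rw [D.symm x i j]
  linear_combination randers a b x y * h2

theorem fundForm_randers (D : IsRandersPair U a b) (h : (x, y) ∈ slit U) (u v : Coord n) :
    alphaFun a x y * fundForm (randers a b) x y u v =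
      alphaFun a x y * ((∑ i, randersDer a b i x y * u i) * ∑ j, randersDer a b j x y * v j)
      + randers a b x y * (∑ i, ∑ j, a x i j * u i * v j
        - (∑ i, alphaDer a i x y * u i) * ∑ j, alphaDer a j x y * v j) := by
  have : ∀ i j, alphaFun a x y * (fundTensor (randers a b) x y i j * u i * v j) =
      alphaFun a x y * ((randersDer a b i x y * u i) * (randersDer a b j x y * v j))
      + randers a b x y * (a x i j * u i * v j
        - (alphaDer a i x y * u i) * (alphaDer a j x y * v j)) := by
    intro i j
    linear_combination (u i * v j) * D.fundTensor_randers h i j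
  simp only [fundForm, Finset.mul_sum, this, Finset.sum_mul, Finset.sum_add_distrib,
    ← Finset.sum_sub_distrib, mul_sub]
  simp only [Finset.sum_sub_distrib]
  congr 1
  · exact Finset.sum_comm
  · congr 1
    exact Finset.sum_comm

/-- The equality case of the Cauchy-Schwarz inequality for `α`: the defect is the squared length of
the component of `u` orthogonal to `y`. -/
theorem alphaSq_sub_sq (D : IsRandersPair U a b) (h : (x, y) ∈ slit U) (u : Coord n) :
    ∑ i, ∑ j, a x i j * u i * u j - (∑ i, alphaDer a i x y * u i) ^ 2 =
      alphaSq a x (u - ((∑ i, alphaDer a i x y * u i) / alphaFun a x y) • y) := by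
  have hα := (D.alphaFun_pos h).ne'
  have e : ∑ k, yLow a k x y * u k = alphaFun a x y * ∑ i, alphaDer a i x y * u i := by
    rw [Finset.mul_sum]
    refine Finset.sum_congr rfl fun k _ => ?_
    rw [← D.alphaDer_mul h]
    ring
  rw [alphaSq_eq_alphaSq_add (D.symm x), e, ← D.alphaFun_sq h]
  simp only [alphaSq]
  field_simp
  ring

theorem fundForm_self (D : IsRandersPair U a b) (h : (x, y) ∈ slit U) (u : Coord n) :
    alphaFun a x y * fundForm (randers a b) x y u u =
      alphaFun a x y * (∑ i, randersDer a b i x y * u i) ^ 2 + randers a b x y *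
        alphaSq a x (u - ((∑ i, alphaDer a i x y * u i) / alphaFun a x y) • y) := by
  rw [D.fundForm_randers h, ← D.alphaSq_sub_sq h]
  ring

theorem alphaSq_nonneg (D : IsRandersPair U a b) (hx : x ∈ U) (y : Coord n) :
    0 ≤ alphaSq a x y := by
  by_cases hy : y = 0
  · simp [alphaSq, hy]
  · exact (D.pos x hx y hy).le

/-- The fundamental tensor of a Randers metric is definite. -/
theorem eq_zero_of_fundForm_self (D : IsRandersPair U a b) (h : (x, y) ∈ slit U) {u : Coord n}
    (hu : fundForm (randers a b) x y u u = 0) : u = 0 := by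
  have h1 := D.fundForm_self h u
  have hα := D.alphaFun_pos h
  have hF := D.randers_pos h
  set c := (∑ i, alphaDer a i x y * u i) / alphaFun a x y
  have h2 := D.alphaSq_nonneg h.1 (u - c • y)
  rw [hu, mul_zero] at h1
  have h3 : 0 ≤ alphaFun a x y * (∑ i, randersDer a b i x y * u i) ^ 2 := by positivity
  have h4 : 0 ≤ randers a b x y * alphaSq a x (u - c • y) := mul_nonneg hF.le h2
  have h5 : alphaSq a x (u - c • y) = 0 := by
    have : randers a b x y * alphaSq a x (u - c • y) = 0 := by linarith
    exact (mul_eq_zero.1 this).resolve_left hF.ne'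
  have h6 : ∑ i, randersDer a b i x y * u i = 0 := by
    have : alphaFun a x y * (∑ i, randersDer a b i x y * u i) ^ 2 = 0 := by linarith
    exact pow_eq_zero_iff two_ne_zero |>.1 ((mul_eq_zero.1 this).resolve_left hα.ne')
  have h7 : u - c • y = 0 := by
    by_contra hne
    exact (D.pos x h.1 _ hne).ne' h5
  have h8 : u = c • y := sub_eq_zero.1 h7
  have h9 : ∑ i, randersDer a b i x y * u i = c * randers a b x y := by
    rw [← D.randersDer_y h, Finset.mul_sum]
    refine Finset.sum_congr rfl fun i _ => ?_
    conv_lhs => rw [h8]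
    simp only [PiLp.smul_apply, smul_eq_mul]
    ring
  have h10 : c = 0 := (mul_eq_zero.1 (h9.symm.trans h6)).resolve_right hF.ne'
  rw [h8, h10, zero_smul]

theorem isUnit_fundTensor (D : IsRandersPair U a b) (h : (x, y) ∈ slit U) :
    IsUnit (fundTensor (randers a b) x y) := by
  refine isUnit_of_mulVec_eq_zero fun v hv => ?_
  have h1 : fundForm (randers a b) x y (WithLp.toLp 2 v) (WithLp.toLp 2 v) =
      ∑ i, v i * (fundTensor (randers a b) x y).mulVec v i := by
    simp only [fundForm, Matrix.mulVec, dotProduct, Finset.mul_sum]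
    exact Finset.sum_congr rfl fun _ _ => Finset.sum_congr rfl fun _ _ => by ring
  have h2 := D.eq_zero_of_fundForm_self h (u := WithLp.toLp 2 v) (by simp [h1, hv])
  simpa using h2

/-- The denominator of the flag curvature does not vanish. -/
theorem flag_denom_ne_zero (D : IsRandersPair U a b) (h : (x, y) ∈ slit U) {u : Coord n}
    (hu : LinearIndependent ℝ ![y, u]) :
    fundForm (randers a b) x y y y * fundForm (randers a b) x y u u
      - fundForm (randers a b) x y y u * fundForm (randers a b) x y y u ≠ 0 := by
  have hα := D.alphaFun_pos h
  have hF := D.randers_pos h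
  set c := (∑ i, alphaDer a i x y * u i) / alphaFun a x y with hc
  have e0 : ∀ v : Coord n, ∑ i, ∑ j, a x i j * y i * v j =
      alphaFun a x y * ∑ j, alphaDer a j x y * v j := by
    intro v
    rw [Finset.sum_comm, Finset.mul_sum]
    refine Finset.sum_congr rfl fun j _ => ?_
    rw [← mul_assoc, D.alphaDer_mul h, yLow, Finset.sum_mul]
  have e1 : ∀ v, fundForm (randers a b) x y y v =
      randers a b x y * ∑ i, randersDer a b i x y * v i := by
    intro v
    refine mul_left_cancel₀ hα.ne' ?_
    rw [D.fundForm_randers h, D.randersDer_y h, D.alphaDer_y h, e0]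
    ring
  have e2 := D.fundForm_self h u
  rw [← hc] at e2
  have hne : u - c • y ≠ 0 := by
    intro h0
    have := LinearIndependent.pair_iff.1 hu (-c) 1 (by rw [← h0]; module)
    exact one_ne_zero this.2
  have hw := D.pos x h.1 _ hne
  rw [e1, e1, D.randersDer_y h]
  intro h0
  have h1 : randers a b x y ^ 2 * (randers a b x y * alphaSq a x (u - c • y)) = 0 := by
    linear_combination alphaFun a x y * h0 - randers a b x y ^ 2 * e2
  have : 0 < randers a b x y ^ 2 * (randers a b x y * alphaSq a x (u - c • y)) := by positivity
  exact this.ne' h1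

/-- The spray coefficients of a Randers metric. -/
theorem geodesicCoeff_randers (D : IsRandersPair U a b) (h : (x, y) ∈ slit U) (i : Fin n) :
    geodesicCoeff (randers a b) i x y = randersSpray a b i x y :=
  geodesicCoeff_eq_of_horizontal D.smooth_randers_sq D.smooth_randersSpray D.isOpen_slit
    (fun _ _ hxy => D.pdx_randers_sq hxy) (fun _ _ hxy => D.spr_randers_sq hxy)
    (fun _ _ hxy => D.euler_randers_sq hxy) h (D.isUnit_fundTensor h) i

/-- The Riemann curvature of a Randers metric is self-adjoint. -/
theorem fundTensor_riemannCurv_comm (D : IsRandersPair U a b) (h : (x, y) ∈ slit U)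
    (k m : Fin n) :
    ∑ i, fundTensor (randers a b) x y m i * riemannCurv (randers a b) i k x y =
      ∑ i, fundTensor (randers a b) x y k i * riemannCurv (randers a b) i m x y := by
  have := sprayCurv_selfAdjoint D.smooth_randers_sq D.smooth_randersSpray D.isOpen_slit
    (fun _ _ hxy => D.pdx_randers_sq hxy) (fun _ _ hxy => D.spr_randers_sq hxy) h k m
  simp only [riemannCurv_eq_sprayCurv, sprayCurv_congr D.isOpen_slit h
    (fun i x y hxy => D.geodesicCoeff_randers hxy i), fundTensor, Matrix.of_apply, mul_assoc,
    ← Finset.mul_sum, this]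

end IsRandersPair

end Spray

/-! ### Parity in the velocity -/

section SCurvature

variable {n : ℕ} {U : Set (Coord n)} {a : Coord n → Matrix (Fin n) (Fin n) ℝ}
  {b : Coord n → Fin n → ℝ} {x y : Coord n}

theorem alphaSq_neg : alphaSq a x (-y) = alphaSq a x y := by simp [alphaSq]

theorem alphaFun_neg : alphaFun a x (-y) = alphaFun a x y := by simp [alphaFun, alphaSq_neg]

theorem betaForm_neg : betaForm b x (-y) = -betaForm b x y := by simp [betaForm]

theorem s_0_neg : s_0 a b x (-y) = -s_0 a b x y := by simp [s_0]

theorem conn_neg (i k : Fin n) : conn a i k x (-y) = -conn a i k x y := by simp [conn]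

theorem leviSpray_neg (i : Fin n) : leviSpray a i x (-y) = leviSpray a i x y := by
  simp [leviSpray, conn_neg]

theorem eForm_neg : eForm a b x (-y) = eForm a b x y := by
  simp [eForm, s_0_neg, betaForm_neg]

theorem neg_mem_slit (h : (x, y) ∈ slit U) : (x, -y) ∈ slit U := ⟨h.1, neg_ne_zero.2 h.2⟩

/-! ### Vanishing S-curvature -/

namespace IsRandersPair

/-- The divergence of the spray of a Randers metric. -/
theorem sum_pdy_randersSpray (D : IsRandersPair U a b) (h : (x, y) ∈ slit U) :
    ∑ i, pdy i (randersSpray a b i) x y = ∑ i, conn a i i x y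
      + (n + 1) * (eFactor a b x y - s_0 a b x y) := by
  have e : ∑ i, pdy i (randersSpray a b i) x y = ∑ i, conn a i i x y
      + (∑ i, pdy i (eFactor a b) x y * y i - ∑ i, sVec a b x i * y i)
      + ∑ i : Fin n, (eFactor a b x y - s_0 a b x y) * kron i i
      + ∑ i, alphaDer a i x y * sUp_0 a b i x y + alphaFun a x y * ∑ i, sUp a b x i i := by
    simp only [D.pdy_randersSpray h, Finset.mul_sum, ← Finset.sum_sub_distrib,
      ← Finset.sum_add_distrib]
    exact Finset.sum_congr rfl fun _ _ => by ring
  rw [e, D.eFactor_homogeneous h, D.alphaDer_sUp_0 h, D.trace_sUp]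
  simp only [s_0, kron, if_true, mul_one, Finset.sum_const, Finset.card_univ, Fintype.card_fin,
    nsmul_eq_mul]
  ring

/-- If the S-curvature vanishes at `x`, so does `e_00`. -/
theorem eForm_eq_zero (D : IsRandersPair U a b) (hx : x ∈ U)
    (hS : ∀ y : Coord n, y ≠ 0 → sCurvature (randers a b) x y = 0) (y : Coord n) :
    eForm a b x y = 0 := by
  by_cases hy : y = 0
  · simp [eForm, hy, s_0]
  have h : (x, y) ∈ slit U := ⟨hx, hy⟩
  have hS' : ∀ y, (x, y) ∈ slit U → ∑ i, conn a i i x y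
      + (n + 1) * (eFactor a b x y - s_0 a b x y)
      - ∑ i, y i * pd i (fun x => Real.log (volumeDensity (randers a b) x)) x = 0 := by
    intro y h
    rw [← D.sum_pdy_randersSpray h, ← hS y h.2]
    simp only [sCurvature]
    congr 1
    exact Finset.sum_congr rfl fun i _ => (pdy_congr D.isOpen_slit h
      (fun x y hxy => D.geodesicCoeff_randers hxy i) i).symm
  -- Apart from `e_00 / (2F)`, all terms of the S-curvature are linear in `y`.
  have h1 := hS' y h
  have h2 := hS' (-y) (neg_mem_slit h)
  simp only [conn_neg, s_0_neg, PiLp.neg_apply, neg_mul, Finset.sum_neg_distrib] at h2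
  have h3 : ((n : ℝ) + 1) * (eFactor a b x y + eFactor a b x (-y)) = 0 := by linarith
  have h4 : eFactor a b x y + eFactor a b x (-y) = 0 :=
    (mul_eq_zero.1 h3).resolve_left (by positivity)
  have hF := D.randers_pos h
  have hF' := D.randers_pos (neg_mem_slit h)
  have h5 := D.eFactor_mul h
  have h6 := D.eFactor_mul (neg_mem_slit h)
  rw [eForm_neg] at h6
  have h7 : eForm a b x y * (randers a b x y + randers a b x (-y)) = 0 := by
    linear_combination 2 * randers a b x y * randers a b x (-y) * h4
      - 2 * randers a b x (-y) * h5 - 2 * randers a b x y * h6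
  exact (mul_eq_zero.1 h7).resolve_right (by positivity)

end IsRandersPair

end SCurvature

/-! ### The Riemann curvature of a Randers metric -/

section Curvature

variable {n : ℕ} {U : Set (Coord n)} {a : Coord n → Matrix (Fin n) (Fin n) ℝ}
  {b : Coord n → Fin n → ℝ} {x y : Coord n}

/-- The deviation `α s^i_0 - s_0 y^i` of the spray of `F` from the spray of `α`, for `e_00 = 0`. -/
def randersDev (a : Coord n → Matrix (Fin n) (Fin n) ℝ) (b : Coord n → Fin n → ℝ) (i : Fin n)
    (x y : Coord n) : ℝ :=
  alphaFun a x y * sUp_0 a b i x y - s_0 a b x y * y i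

/-- The vertical derivative `∂/∂y^k` of the deviation. -/
def randersDevDer (a : Coord n → Matrix (Fin n) (Fin n) ℝ) (b : Coord n → Fin n → ℝ)
    (i k : Fin n) (x y : Coord n) : ℝ :=
  alphaDer a k x y * sUp_0 a b i x y + alphaFun a x y * sUp a b x i k
    - (sVec a b x k * y i + s_0 a b x y * kron i k)

/-- The right-hand side of the equation for the Riemann curvature of `α`. -/
def evenPart (a : Coord n → Matrix (Fin n) (Fin n) ℝ) (b : Coord n → Fin n → ℝ) (i k : Fin n)
    (x y : Coord n) : ℝ :=
  -(s_0_cov_0 a b x y * kron i k - s_0_cov a b k x y * y i)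
    - (s_cov_0 a b k x y - s_0_cov a b k x y) * y i
    - s_0 a b x y * (s_0 a b x y * kron i k - sVec a b x k * y i)
    + (alphaSq a x y * ∑ j, sUp a b x i j * sUp a b x j k
        - (∑ j, sUp a b x i j * sUp_0 a b j x y) * yLow a k x y)
    - 3 * sLow_0 a b k x y * sUp_0 a b i x y

/-- The right-hand side of the second equation. -/
def oddPart (a : Coord n → Matrix (Fin n) (Fin n) ℝ) (b : Coord n → Fin n → ℝ) (i k : Fin n)
    (x y : Coord n) : ℝ :=
  (∑ j, sVec a b x j * sUp_0 a b j x y) * (alphaSq a x y * kron i k - yLow a k x y * y i)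
    + alphaSq a x y * ((∑ j, sVec a b x j * sUp_0 a b j x y) * kron i k
        - (∑ j, sVec a b x j * sUp a b x j k) * y i)
    + alphaSq a x y * (sUp_cov_0 a b i k x y - sUp_0_cov a b i k x y)
    - (alphaSq a x y * sUp_0_cov a b i k x y - sUp_0_cov_0 a b i x y * yLow a k x y)

theorem spr_vel (i : Fin n) :
    spr (leviSpray a) (fun _ y => y i) x y = -(2 * leviSpray a i x y) := by
  have e : ∀ j, 2 * (leviSpray a j x y * kron i j) = (2 * leviSpray a j x y) * kron i j :=
    fun _ => by ring
  simp only [spr, pdx_vel, pdy_vel, e, mul_zero, zero_sub, Finset.sum_neg_distrib]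
  simp [kron]

namespace IsRandersPair

theorem smooth_sUp_slit (D : IsRandersPair U a b) (i k : Fin n) :
    SmoothOn (slit U) (fun x _ => sUp a b x i k) :=
  .position (D.smooth_sUp i k) fun _ hz => hz.1

theorem smooth_sVec_slit (D : IsRandersPair U a b) (k : Fin n) :
    SmoothOn (slit U) (fun x _ => sVec a b x k) :=
  .position (D.smooth_sVec k) fun _ hz => hz.1

theorem smooth_sUp_0_slit (D : IsRandersPair U a b) (i : Fin n) : SmoothOn (slit U) (sUp_0 a b i) :=
  (D.smooth_sUp_0 i).mono slit_subset

theorem smooth_s_0_slit (D : IsRandersPair U a b) : SmoothOn (slit U) (s_0 a b) :=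
  D.smooth_s_0.mono slit_subset

theorem smooth_randersDev (D : IsRandersPair U a b) (i : Fin n) :
    SmoothOn (slit U) (randersDev a b i) :=
  (D.smooth_alphaFun.mul (D.smooth_sUp_0_slit i)).sub (D.smooth_s_0_slit.mul (.vel i))

theorem pdy_randersDev (D : IsRandersPair U a b) (h : (x, y) ∈ slit U) (i k : Fin n) :
    pdy k (randersDev a b i) x y = randersDevDer a b i k x y := by
  refine (pdy_sub (D.smooth_alphaFun.mul (D.smooth_sUp_0_slit i)) (D.smooth_s_0_slit.mul (.vel i))
    D.isOpen_slit h k).trans ?_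
  rw [pdy_mul D.smooth_alphaFun (D.smooth_sUp_0_slit i) D.isOpen_slit h,
    pdy_mul D.smooth_s_0_slit (.vel i) D.isOpen_slit h, D.pdy_alphaFun h, pdy_sUp_0, pdy_s_0,
      pdy_vel]
  rfl

theorem pdx_randersDev (D : IsRandersPair U a b) (h : (x, y) ∈ slit U) (i k : Fin n) :
    pdx k (randersDev a b i) x y = (∑ l, alphaDer a l x y * conn a l k x y) * sUp_0 a b i x y
      + alphaFun a x y * (sUp_0_cov a b i k x y - ∑ l, christoffel a i k l x * sUp_0 a b l x y
        + ∑ l, sUp a b x i l * conn a l k x y)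
      - (s_0_cov a b k x y + ∑ l, sVec a b x l * conn a l k x y) * y i := by
  have e1 : pdx k (sUp_0 a b i) x y = _ := D.pdx_mixed (D.smooth_sUp i) h.1 k
  have e2 : pdx k (s_0 a b) x y = _ := D.pdx_covector D.smooth_sVec h.1 k
  refine (pdx_sub (D.smooth_alphaFun.mul (D.smooth_sUp_0_slit i)) (D.smooth_s_0_slit.mul (.vel i))
    D.isOpen_slit h k).trans ?_
  rw [pdx_mul D.smooth_alphaFun (D.smooth_sUp_0_slit i) D.isOpen_slit h,
    pdx_mul D.smooth_s_0_slit (.vel i) D.isOpen_slit h, D.pdx_alphaFun h, e1, e2, pdx_vel]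
  simp only [sUp_0_cov, sUpCov, sUp_0, s_0_cov, sVecCov]
  ring

theorem smooth_devDer_terms (D : IsRandersPair U a b) (i k : Fin n) :
    SmoothOn (slit U) (fun x y => alphaDer a k x y * sUp_0 a b i x y) ∧
    SmoothOn (slit U) (fun x y => alphaFun a x y * sUp a b x i k) ∧
    SmoothOn (slit U) (fun x y => sVec a b x k * y i) ∧
    SmoothOn (slit U) (fun x y => s_0 a b x y * kron i k) :=
  ⟨(D.smooth_alphaDer k).mul (D.smooth_sUp_0_slit i), D.smooth_alphaFun.mul (D.smooth_sUp_slit i k),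
    (D.smooth_sVec_slit k).mul (.vel i), D.smooth_s_0_slit.mul (.const _)⟩

theorem pdy_randersDevDer (D : IsRandersPair U a b) (h : (x, y) ∈ slit U) (i k j : Fin n) :
    pdy j (randersDevDer a b i k) x y = pdy j (alphaDer a k) x y * sUp_0 a b i x y
      + alphaDer a k x y * sUp a b x i j + alphaDer a j x y * sUp a b x i k
      - sVec a b x k * kron i j - sVec a b x j * kron i k := by
  obtain ⟨t1, t2, t3, t4⟩ := D.smooth_devDer_terms i k
  refine (pdy_sub (t1.add t2) (t3.add t4) D.isOpen_slit h j).trans ?_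
  rw [pdy_add t1 t2 D.isOpen_slit h, pdy_add t3 t4 D.isOpen_slit h,
    pdy_mul (D.smooth_alphaDer k) (D.smooth_sUp_0_slit i) D.isOpen_slit h,
    pdy_mul D.smooth_alphaFun (D.smooth_sUp_slit i k) D.isOpen_slit h,
    pdy_mul (D.smooth_sVec_slit k) (.vel i) D.isOpen_slit h,
    pdy_mul D.smooth_s_0_slit (.const _) D.isOpen_slit h, D.pdy_alphaFun h, pdy_sUp_0, pdy_s_0,
    pdy_vel, pdy_const, pdy_pos, pdy_pos]
  ring

theorem spr_randersDevDer (D : IsRandersPair U a b) (h : (x, y) ∈ slit U) (i k : Fin n) :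
    spr (leviSpray a) (randersDevDer a b i k) x y =
      (∑ l, alphaDer a l x y * conn a l k x y) * sUp_0 a b i x y
      + alphaDer a k x y * (sUp_0_cov_0 a b i x y - ∑ l, conn a i l x y * sUp_0 a b l x y)
      + alphaFun a x y * (sUp_cov_0 a b i k x y - ∑ l, conn a i l x y * sUp a b x l k
        + ∑ l, sUp a b x i l * conn a l k x y)
      - (s_cov_0 a b k x y + ∑ l, sVec a b x l * conn a l k x y) * y i
      + sVec a b x k * (2 * leviSpray a i x y) - s_0_cov_0 a b x y * kron i k := by
  obtain ⟨t1, t2, t3, t4⟩ := D.smooth_devDer_terms i k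
  have e1 : spr (leviSpray a) (sUp_0 a b i) x y = _ := D.spr_mixed (D.smooth_sUp i) h.1
  have e2 : spr (leviSpray a) (s_0 a b) x y = _ := D.spr_covector D.smooth_sVec h.1
  have e3 : spr (leviSpray a) (fun x _ => sUp a b x i k) x y = _ :=
    D.spr_mixed_component (sUp a b) i k
  have e4 : spr (leviSpray a) (fun x _ => sVec a b x k) x y = _ :=
    spr_covector_component (sVec a b) k
  have e5 : spr (leviSpray a) (fun _ _ => kron i k) x y = 0 := by
    simp [spr, pdx_const, pdy_const]
  refine (spr_sub (t1.add t2) (t3.add t4) D.isOpen_slit h).trans ?_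
  rw [spr_add t1 t2 D.isOpen_slit h, spr_add t3 t4 D.isOpen_slit h,
    spr_mul (D.smooth_alphaDer k) (D.smooth_sUp_0_slit i) D.isOpen_slit h,
    spr_mul D.smooth_alphaFun (D.smooth_sUp_slit i k) D.isOpen_slit h,
    spr_mul (D.smooth_sVec_slit k) (.vel i) D.isOpen_slit h,
    spr_mul D.smooth_s_0_slit (.const _) D.isOpen_slit h, D.spr_alphaFun h, D.spr_alphaDer h,
    e1, e2, e3, e4, e5, spr_vel]
  have c1 : ∑ l, alphaDer a l x y * conn a l k x y = ∑ l, conn a l k x y * alphaDer a l x y :=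
    Finset.sum_congr rfl fun _ _ => mul_comm _ _
  have c2 : ∑ l, sUp a b x i l * conn a l k x y = ∑ l, conn a l k x y * sUp a b x i l :=
    Finset.sum_congr rfl fun _ _ => mul_comm _ _
  have c3 : ∑ l, sVec a b x l * conn a l k x y = ∑ l, conn a l k x y * sVec a b x l :=
    Finset.sum_congr rfl fun _ _ => mul_comm _ _
  rw [c1, c2, c3]
  simp only [sUp_0_cov_0, sUp_cov_0, sUpCov, sUp_0, s_0_cov_0, s_cov_0, sVecCov]
  ring

theorem sum_dev_christoffel (i k : Fin n) :
    ∑ j, randersDev a b j x y * christoffel a i k j x =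
      alphaFun a x y * ∑ l, christoffel a i k l x * sUp_0 a b l x y
        - s_0 a b x y * conn a i k x y := by
  simp only [conn, Finset.mul_sum, ← Finset.sum_sub_distrib, randersDev]
  exact Finset.sum_congr rfl fun _ _ => by ring

theorem sum_conn_devDer (i k : Fin n) :
    ∑ j, conn a i j x y * randersDevDer a b j k x y =
      alphaDer a k x y * ∑ l, conn a i l x y * sUp_0 a b l x y
      + alphaFun a x y * ∑ l, conn a i l x y * sUp a b x l k
      - sVec a b x k * (2 * leviSpray a i x y) - s_0 a b x y * conn a i k x y := by
  rw [← sum_mul_kron' (fun j => conn a i j x y) k]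
  simp only [leviSpray, ← mul_assoc, Finset.mul_sum, ← Finset.sum_sub_distrib,
    ← Finset.sum_add_distrib, randersDevDer]
  exact Finset.sum_congr rfl fun _ _ => by ring

theorem sum_devDer_conn (i k : Fin n) :
    ∑ j, randersDevDer a b i j x y * conn a j k x y =
      (∑ l, alphaDer a l x y * conn a l k x y) * sUp_0 a b i x y
      + alphaFun a x y * ∑ l, sUp a b x i l * conn a l k x y
      - (∑ l, sVec a b x l * conn a l k x y) * y i - s_0 a b x y * conn a i k x y := by
  rw [← sum_mul_kron (fun j => conn a j k x y) i]
  simp only [Finset.mul_sum, Finset.sum_mul, ← Finset.sum_sub_distrib, ← Finset.sum_add_distrib,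
    randersDevDer]
  exact Finset.sum_congr rfl fun _ _ => by ring

end IsRandersPair

end Curvature

section Curvature

variable {n : ℕ} {U : Set (Coord n)} {a : Coord n → Matrix (Fin n) (Fin n) ℝ}
  {b : Coord n → Fin n → ℝ} {x y : Coord n}

namespace IsRandersPair

/-- The Hessian of `α` in the velocity has kernel spanned by `y`, so only the component `α s^i_0` of
the deviation contributes. -/
theorem sum_dev_hessian (D : IsRandersPair U a b) (h : (x, y) ∈ slit U) (k : Fin n) :
    ∑ j, randersDev a b j x y * pdy j (alphaDer a k) x y = sLow_0 a b k x y := by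
  refine mul_left_cancel₀ (D.alphaFun_pos h).ne' ?_
  have e : alphaFun a x y * ∑ j, randersDev a b j x y * pdy j (alphaDer a k) x y =
      alphaFun a x y * (∑ j, a x j k * sUp_0 a b j x y
        - alphaDer a k x y * ∑ j, alphaDer a j x y * sUp_0 a b j x y)
      - s_0 a b x y * (∑ j, a x j k * y j
        - alphaDer a k x y * ∑ j, alphaDer a j x y * y j) := by
    simp only [Finset.mul_sum, ← Finset.sum_sub_distrib, randersDev]
    refine Finset.sum_congr rfl fun j _ => ?_
    linear_combination (alphaFun a x y * sUp_0 a b j x y - s_0 a b x y * y j) *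
      D.pdy_alphaDer h j k
  have e' : ∑ j, a x j k * y j = alphaFun a x y * alphaDer a k x y := (D.alphaDer_mul h k).symm
  rw [e, e', D.lower_sUp_0 h.1, D.alphaDer_sUp_0 h, D.alphaDer_y h]
  ring

theorem sum_dev_pdy_devDer (D : IsRandersPair U a b) (h : (x, y) ∈ slit U) (i k : Fin n) :
    ∑ j, randersDev a b j x y * pdy j (randersDevDer a b i k) x y =
      sLow_0 a b k x y * sUp_0 a b i x y
      + alphaDer a k x y * (alphaFun a x y * ∑ j, sUp a b x i j * sUp_0 a b j x y
        - s_0 a b x y * sUp_0 a b i x y)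
      - s_0 a b x y * alphaFun a x y * sUp a b x i k - sVec a b x k * randersDev a b i x y
      - (alphaFun a x y * ∑ j, sVec a b x j * sUp_0 a b j x y - s_0 a b x y ^ 2) * kron i k := by
  have e1 : ∑ j, randersDev a b j x y * pdy j (randersDevDer a b i k) x y =
      (∑ j, randersDev a b j x y * pdy j (alphaDer a k) x y) * sUp_0 a b i x y
      + alphaDer a k x y * ∑ j, randersDev a b j x y * sUp a b x i j
      + (∑ j, randersDev a b j x y * alphaDer a j x y) * sUp a b x i k
      - sVec a b x k * ∑ j, randersDev a b j x y * kron i j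
      - (∑ j, randersDev a b j x y * sVec a b x j) * kron i k := by
    simp only [Finset.mul_sum, Finset.sum_mul, ← Finset.sum_sub_distrib,
      ← Finset.sum_add_distrib, D.pdy_randersDevDer h]
    exact Finset.sum_congr rfl fun _ _ => by ring
  have e2 : ∑ j, randersDev a b j x y * sUp a b x i j =
      alphaFun a x y * ∑ j, sUp a b x i j * sUp_0 a b j x y - s_0 a b x y * sUp_0 a b i x y := by
    conv_rhs => rw [sUp_0]
    simp only [Finset.mul_sum, ← Finset.sum_sub_distrib, randersDev]
    exact Finset.sum_congr rfl fun _ _ => by ring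
  have e3 : ∑ j, randersDev a b j x y * alphaDer a j x y =
      -(s_0 a b x y * alphaFun a x y) := by
    have : ∑ j, randersDev a b j x y * alphaDer a j x y =
        alphaFun a x y * ∑ j, alphaDer a j x y * sUp_0 a b j x y
          - s_0 a b x y * ∑ j, alphaDer a j x y * y j := by
      simp only [Finset.mul_sum, ← Finset.sum_sub_distrib, randersDev]
      exact Finset.sum_congr rfl fun _ _ => by ring
    rw [this, D.alphaDer_sUp_0 h, D.alphaDer_y h]
    ring
  have e4 : ∑ j, randersDev a b j x y * sVec a b x j =
      alphaFun a x y * ∑ j, sVec a b x j * sUp_0 a b j x y - s_0 a b x y ^ 2 := by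
    have : ∑ j, randersDev a b j x y * sVec a b x j =
        alphaFun a x y * ∑ j, sVec a b x j * sUp_0 a b j x y
          - s_0 a b x y * ∑ j, sVec a b x j * y j := by
      simp only [Finset.mul_sum, ← Finset.sum_sub_distrib, randersDev]
      exact Finset.sum_congr rfl fun _ _ => by ring
    rw [this, sq]
    rfl
  have e5 : ∑ j, randersDev a b j x y * kron i j = randersDev a b i x y := by simp [kron]
  rw [e1, D.sum_dev_hessian h, e2, e3, e4, e5]
  ring

theorem sum_devDer_devDer (D : IsRandersPair U a b) (h : (x, y) ∈ slit U) (i k : Fin n) :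
    ∑ j, randersDevDer a b i j x y * randersDevDer a b j k x y =
      -(sUp_0 a b i x y * (sLow_0 a b k x y + sVec a b x k * alphaFun a x y
        + s_0 a b x y * alphaDer a k x y))
      + alphaFun a x y * (alphaDer a k x y * ∑ j, sUp a b x i j * sUp_0 a b j x y
        + alphaFun a x y * ∑ j, sUp a b x i j * sUp a b x j k
        - sVec a b x k * sUp_0 a b i x y - s_0 a b x y * sUp a b x i k)
      - y i * (alphaDer a k x y * ∑ j, sVec a b x j * sUp_0 a b j x y
        + alphaFun a x y * ∑ j, sVec a b x j * sUp a b x j k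
        - 2 * (s_0 a b x y * sVec a b x k))
      - s_0 a b x y * randersDevDer a b i k x y := by
  have t : ∀ v : Fin n → ℝ, ∑ j, v j * randersDevDer a b j k x y =
      alphaDer a k x y * ∑ j, v j * sUp_0 a b j x y + alphaFun a x y * ∑ j, v j * sUp a b x j k
        - sVec a b x k * ∑ j, v j * y j - s_0 a b x y * v k := by
    intro v
    rw [← sum_mul_kron' v k]
    simp only [Finset.mul_sum, ← Finset.sum_sub_distrib, ← Finset.sum_add_distrib,
      randersDevDer]
    exact Finset.sum_congr rfl fun _ _ => by ring
  have e1 : ∑ j, randersDevDer a b i j x y * randersDevDer a b j k x y =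
      sUp_0 a b i x y * ∑ j, alphaDer a j x y * randersDevDer a b j k x y
      + alphaFun a x y * ∑ j, sUp a b x i j * randersDevDer a b j k x y
      - y i * ∑ j, sVec a b x j * randersDevDer a b j k x y
      - s_0 a b x y * ∑ j, randersDevDer a b j k x y * kron i j := by
    simp only [Finset.mul_sum, ← Finset.sum_sub_distrib, ← Finset.sum_add_distrib]
    refine Finset.sum_congr rfl fun j _ => ?_
    conv_lhs => rw [randersDevDer]
    ring
  have e2 : ∑ j, randersDevDer a b j k x y * kron i j = randersDevDer a b i k x y := by
    simp [kron]
  have e3 : ∑ j, sUp a b x i j * y j = sUp_0 a b i x y := rfl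
  have e4 : ∑ j, sVec a b x j * y j = s_0 a b x y := rfl
  rw [e1, e2, t, t, t, D.alphaDer_sUp_0 h, D.alphaDer_sUp h, D.alphaDer_y h, e3, e4]
  ring

/-- The Riemann curvature of a Randers metric with `e_00 = 0`. -/
theorem sprayCurv_dev (D : IsRandersPair U a b) (h : (x, y) ∈ slit U) (i k : Fin n) :
    alphaFun a x y * sprayCurv (fun i x y => leviSpray a i x y + randersDev a b i x y) i k x y =
      alphaFun a x y * (sprayCurv (leviSpray a) i k x y - evenPart a b i k x y)
        - oddPart a b i k x y := by
  rw [sprayCurv_add (fun i => (D.smooth_leviSpray i).mono slit_subset) D.smooth_randersDev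
    D.isOpen_slit h]
  have c1 : ∀ j, pdy j (pdy k (leviSpray a i)) x y = christoffel a i k j x := fun j => by
    rw [pdy_congr D.isOpen_slit h (fun x y hxy => D.pdy_leviSpray hxy.1 i k), pdy_conn]
  have c2 : ∀ j, pdy j (pdy k (randersDev a b i)) x y = pdy j (randersDevDer a b i k) x y :=
    fun j => pdy_congr D.isOpen_slit h (fun x y hxy => D.pdy_randersDev hxy i k) j
  rw [spr_congr D.isOpen_slit h (fun x y hxy => D.pdy_randersDev hxy i k)]
  simp only [c1, c2, D.pdy_leviSpray h.1, D.pdy_randersDev h]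
  rw [D.pdx_randersDev h, D.spr_randersDevDer h, sum_dev_christoffel, sum_conn_devDer,
    sum_devDer_conn, D.sum_dev_pdy_devDer h, D.sum_devDer_devDer h]
  simp only [evenPart, oddPart, ← D.alphaFun_sq h, ← D.alphaDer_mul h, randersDev, randersDevDer]
  ring

/-! ### The Riemann curvature of `α` -/

theorem alphaFun_sq_eqOn (D : IsRandersPair U a b) :
    ∀ x y, (x, y) ∈ U ×ˢ (Set.univ : Set (Coord n)) → alphaFun a x y ^ 2 = alphaSq a x y :=
  fun _ _ h => Real.sq_sqrt (D.alphaSq_nonneg h.1 _)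

/-- The geodesic spray of `α`. The identity also holds at zero velocity, because only `α²`
enters. -/
theorem geodesicCoeff_alphaFun (D : IsRandersPair U a b) (hx : x ∈ U) (i : Fin n) :
    geodesicCoeff (alphaFun a) i x y = leviSpray a i x y := by
  have hΩ := D.isOpen_full
  have h : (x, y) ∈ U ×ˢ (Set.univ : Set (Coord n)) := ⟨hx, trivial⟩
  have ex : ∀ x y, (x, y) ∈ U ×ˢ (Set.univ : Set (Coord n)) → ∀ k,
      pdx k (fun x y => alphaFun a x y ^ 2) x y = 2 * ∑ l, yLow a l x y * conn a l k x y :=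
    fun x y hxy k => by rw [pdx_congr hΩ hxy D.alphaFun_sq_eqOn, D.pdx_alphaSq hxy.1]
  have ey : ∀ x y, (x, y) ∈ U ×ˢ (Set.univ : Set (Coord n)) → ∀ k,
      pdy k (fun x y => alphaFun a x y ^ 2) x y = 2 * yLow a k x y :=
    fun x y hxy k => by rw [pdy_congr hΩ hxy D.alphaFun_sq_eqOn, D.pdy_alphaSq hxy.1]
  have hhor : ∀ x y, (x, y) ∈ U ×ˢ (Set.univ : Set (Coord n)) → ∀ k,
      pdx k (fun x y => alphaFun a x y ^ 2) x y = ∑ i, pdy k (leviSpray a i) x y *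
        pdy i (fun x y => alphaFun a x y ^ 2) x y := by
    intro x y hxy k
    simp only [ex x y hxy, ey x y hxy, D.pdy_leviSpray hxy.1, Finset.mul_sum]
    exact Finset.sum_congr rfl fun _ _ => by ring
  refine geodesicCoeff_eq_of_horizontal (D.smooth_alphaSq.congr fun z hz =>
    D.alphaFun_sq_eqOn z.1 z.2 hz) D.smooth_leviSpray hΩ hhor ?_ ?_ h ?_ i
  · intro x y hxy
    rw [spr_leviSpray]
    refine Finset.sum_eq_zero fun j _ => ?_
    simp only [ex x y hxy, ey x y hxy, Finset.mul_sum, mul_assoc, sub_self, mul_zero]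
  · intro x y hxy
    simp only [ey x y hxy, mul_assoc, ← Finset.mul_sum, ← alphaSq_eq_sum_yLow]
    rw [D.alphaFun_sq_eqOn x y hxy]
  · have : fundTensor (alphaFun a) x y = a x := by
      ext i j
      simp only [fundTensor, Matrix.of_apply]
      rw [pdy_congr (g := fun x y => 2 * yLow a i x y) hΩ h (fun x y hxy => ey x y hxy i),
        pdy_mul (.const 2) (D.smooth_yLow i) hΩ h, pdy_const, pdy_yLow, D.symm x j i]
      ring
    rw [this]
    exact D.isUnit_a hx

theorem riemannCurv_alphaFun (D : IsRandersPair U a b) (hx : x ∈ U) (i k : Fin n) :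
    riemannCurv (alphaFun a) i k x y = sprayCurv (leviSpray a) i k x y := by
  rw [riemannCurv_eq_sprayCurv]
  exact sprayCurv_congr D.isOpen_full ⟨hx, trivial⟩
    (fun i x y hxy => D.geodesicCoeff_alphaFun hxy.1 i) i k

theorem sprayCurv_leviSpray (D : IsRandersPair U a b) (hx : x ∈ U) (i k : Fin n) :
    sprayCurv (leviSpray a) i k x y = 2 * pdx k (leviSpray a i) x y
      - ∑ j, (y j * pdx j (conn a i k) x y - 2 * (leviSpray a j x y * christoffel a i k j x))
      - ∑ j, conn a i j x y * conn a j k x y := by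
  have h : (x, y) ∈ U ×ˢ (Set.univ : Set (Coord n)) := ⟨hx, trivial⟩
  rw [sprayCurv, spr_congr D.isOpen_full h (fun x y hxy => D.pdy_leviSpray hxy.1 i k)]
  simp only [D.pdy_leviSpray hx, spr, pdy_conn]

theorem sprayCurv_leviSpray_neg (D : IsRandersPair U a b) (hx : x ∈ U) (i k : Fin n) :
    sprayCurv (leviSpray a) i k x (-y) = sprayCurv (leviSpray a) i k x y := by
  have e1 : pdx k (leviSpray a i) x (-y) = pdx k (leviSpray a i) x y := by
    simp only [pdx, leviSpray_neg]
  have e2 : ∀ j, pdx j (conn a i k) x (-y) = -pdx j (conn a i k) x y := by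
    intro j
    simp only [pdx, pd, conn_neg, fderiv_fun_neg, _root_.neg_apply]
  simp only [D.sprayCurv_leviSpray hx, e1, e2, leviSpray_neg, conn_neg, PiLp.neg_apply, neg_mul_neg]

/-- The curvature of the spray of `α` vanishes at zero velocity, where `α` itself is not
differentiable. -/
theorem sprayCurv_leviSpray_zero (D : IsRandersPair U a b) (hx : x ∈ U) (i k : Fin n) :
    sprayCurv (leviSpray a) i k x 0 = 0 := by
  have e1 : ∀ i x, leviSpray a i x 0 = 0 := fun i x => by simp [leviSpray]
  have e2 : ∀ i j, conn a i j x 0 = 0 := fun i j => by simp [conn]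
  simp [D.sprayCurv_leviSpray hx, e1, e2, pdx, pd]

end IsRandersPair

theorem evenPart_neg (i k : Fin n) : evenPart a b i k x (-y) = evenPart a b i k x y := by
  simp only [evenPart, s_0_cov_0, s_0_cov, s_cov_0, s_0, sUp_0, sLow_0, yLow, alphaSq_neg,
    PiLp.neg_apply, mul_neg, neg_mul, Finset.sum_neg_distrib, neg_neg]
  ring

theorem oddPart_neg (i k : Fin n) : oddPart a b i k x (-y) = -oddPart a b i k x y := by
  simp only [oddPart, sUp_0_cov_0, sUp_0_cov, sUp_cov_0, sUp_0, yLow, alphaSq_neg,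
    PiLp.neg_apply, mul_neg, neg_mul, Finset.sum_neg_distrib, neg_neg]
  ring

theorem evenPart_zero (i k : Fin n) : evenPart a b i k x 0 = 0 := by
  simp [evenPart, s_0_cov_0, s_0_cov, s_0, sLow_0, alphaSq, yLow]

theorem oddPart_zero (i k : Fin n) : oddPart a b i k x 0 = 0 := by
  simp [oddPart, alphaSq, yLow]

namespace IsRandersPair

/-- The Riemann curvature of `F` splits into a part that is even and a part that is odd in the
velocity. -/
theorem riemannCurv_randers (D : IsRandersPair U a b)
    (he : ∀ x ∈ U, ∀ y : Coord n, eForm a b x y = 0) (h : (x, y) ∈ slit U) (i k : Fin n) :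
    alphaFun a x y * riemannCurv (randers a b) i k x y =
      alphaFun a x y * (riemannCurv (alphaFun a) i k x y - evenPart a b i k x y)
        - oddPart a b i k x y := by
  rw [D.riemannCurv_alphaFun h.1, ← D.sprayCurv_dev h, riemannCurv_eq_sprayCurv]
  congr 1
  refine sprayCurv_congr D.isOpen_slit h (fun i x y hxy => ?_) i k
  rw [D.geodesicCoeff_randers hxy]
  simp only [randersSpray, randersDev, eFactor, he x hxy.1, zero_div]
  ring

/-- The Riemann curvature of `F` vanishes if and only if both of its parts do. -/
theorem riemannCurv_eq_zero_iff (D : IsRandersPair U a b)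
    (he : ∀ x ∈ U, ∀ y : Coord n, eForm a b x y = 0) (hx : x ∈ U) (i k : Fin n) :
    (∀ y, y ≠ 0 → riemannCurv (randers a b) i k x y = 0) ↔
      ∀ y, riemannCurv (alphaFun a) i k x y = evenPart a b i k x y ∧ 0 = oddPart a b i k x y := by
  constructor
  · intro hR y
    by_cases hy : y = 0
    · rw [hy, D.riemannCurv_alphaFun hx, D.sprayCurv_leviSpray_zero hx, evenPart_zero,
        oddPart_zero]
      exact ⟨rfl, rfl⟩
    have h : (x, y) ∈ slit U := ⟨hx, hy⟩
    have h1 := D.riemannCurv_randers he h i k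
    have h2 := D.riemannCurv_randers he (neg_mem_slit h) i k
    rw [hR y hy] at h1
    rw [hR (-y) (neg_ne_zero.2 hy), D.riemannCurv_alphaFun hx, D.sprayCurv_leviSpray_neg hx,
      ← D.riemannCurv_alphaFun hx, alphaFun_neg, evenPart_neg, oddPart_neg] at h2
    have h3 : alphaFun a x y * (riemannCurv (alphaFun a) i k x y - evenPart a b i k x y) = 0 := by
      linarith
    exact ⟨sub_eq_zero.1 ((mul_eq_zero.1 h3).resolve_left (D.alphaFun_pos h).ne'), by linarith⟩
  · intro hE y hy
    have h : (x, y) ∈ slit U := ⟨hx, hy⟩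
    have h1 := D.riemannCurv_randers he h i k
    rw [(hE y).1, ← (hE y).2, sub_self, mul_zero, sub_zero] at h1
    exact (mul_eq_zero.1 h1).resolve_left (D.alphaFun_pos h).ne'

/-! ### Flag curvature -/

theorem riemannCurv_y (D : IsRandersPair U a b) (h : (x, y) ∈ slit U) (i : Fin n) :
    ∑ k, riemannCurv (randers a b) i k x y * y k = 0 := by
  simp only [riemannCurv_eq_sprayCurv, sprayCurv_congr D.isOpen_slit h
    (fun i x y hxy => D.geodesicCoeff_randers hxy i)]
  exact sprayCurv_y D.smooth_randersSpray D.isOpen_slit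
    (fun i _ _ hxy => D.randersSpray_homogeneous hxy i) h i

/-- Self-adjointness of the Riemann curvature, in terms of the bilinear form `g_y`. -/
theorem fundForm_riemannMap (D : IsRandersPair U a b) (h : (x, y) ∈ slit U) (u v : Coord n) :
    fundForm (randers a b) x y (riemannMap (randers a b) x y u) v =
      fundForm (randers a b) x y (riemannMap (randers a b) x y v) u := by
  have hs : ∀ i j, fundTensor (randers a b) x y i j = fundTensor (randers a b) x y j i := by
    intro i j
    refine mul_left_cancel₀ (D.alphaFun_pos h).ne' ?_
    rw [D.fundTensor_randers h, D.fundTensor_randers h, D.symm x i j]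
    ring
  have e : ∀ u v, fundForm (randers a b) x y (riemannMap (randers a b) x y u) v =
      ∑ m, ∑ k, (∑ i, fundTensor (randers a b) x y m i * riemannCurv (randers a b) i k x y)
        * u k * v m := by
    intro u v
    simp only [fundForm, riemannMap, Finset.mul_sum, Finset.sum_mul]
    rw [Finset.sum_comm]
    refine Finset.sum_congr rfl fun m _ => ?_
    rw [Finset.sum_comm]
    refine Finset.sum_congr rfl fun k _ => Finset.sum_congr rfl fun i _ => ?_
    rw [hs i m]
    ring
  rw [e, e, Finset.sum_comm]
  refine Finset.sum_congr rfl fun m _ => Finset.sum_congr rfl fun k _ => ?_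
  rw [D.fundTensor_riemannCurv_comm h]
  ring

/-- The flag curvatures with flagpole `y` vanish if and only if the Riemann curvature does. -/
theorem flagCurvature_eq_zero_iff (D : IsRandersPair U a b) (h : (x, y) ∈ slit U) :
    (∀ u, LinearIndependent ℝ ![y, u] → flagCurvature (randers a b) x y u = 0) ↔
      ∀ i k, riemannCurv (randers a b) i k x y = 0 := by
  have hadd : ∀ u v, riemannMap (randers a b) x y (u + v) =
      riemannMap (randers a b) x y u + riemannMap (randers a b) x y v := by
    intro u v
    ext i
    simp [riemannMap, mul_add, Finset.sum_add_distrib]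
  have hsmul : ∀ (c : ℝ) u, riemannMap (randers a b) x y (c • u) =
      c • riemannMap (randers a b) x y u := by
    intro c u
    ext i
    simp only [riemannMap, PiLp.smul_apply, smul_eq_mul, Finset.mul_sum]
    exact Finset.sum_congr rfl fun _ _ => by ring
  have fadd : ∀ u v w, fundForm (randers a b) x y (u + v) w =
      fundForm (randers a b) x y u w + fundForm (randers a b) x y v w := by
    intro u v w
    simp [fundForm, mul_add, add_mul, Finset.sum_add_distrib]
  have fadd' : ∀ u v w, fundForm (randers a b) x y w (u + v) =
      fundForm (randers a b) x y w u + fundForm (randers a b) x y w v := by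
    intro u v w
    simp [fundForm, mul_add, Finset.sum_add_distrib]
  have hy : riemannMap (randers a b) x y y = 0 := by
    ext i
    exact D.riemannCurv_y h i
  have f0 : ∀ w, fundForm (randers a b) x y 0 w = 0 := fun w => by simp [fundForm]
  constructor
  · intro hK
    have hB : ∀ u, fundForm (randers a b) x y (riemannMap (randers a b) x y u) u = 0 := by
      intro u
      by_cases hu : LinearIndependent ℝ ![y, u]
      · exact (div_eq_zero_iff.1 (hK u hu)).resolve_right (D.flag_denom_ne_zero h hu)
      · rw [LinearIndependent.pair_iff' h.2] at hu
        push Not at hu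
        obtain ⟨c, rfl⟩ := hu
        rw [hsmul, hy, smul_zero, f0]
    -- Polarisation: a self-adjoint map with vanishing quadratic form vanishes.
    have hB' : ∀ u v, fundForm (randers a b) x y (riemannMap (randers a b) x y u) v = 0 := by
      intro u v
      have h1 := hB (u + v)
      rw [hadd, fadd, fadd', fadd', hB u, hB v, D.fundForm_riemannMap h v u] at h1
      linarith
    intro i k
    have h2 := D.eq_zero_of_fundForm_self h
      (hB' (EuclideanSpace.single k 1) (riemannMap (randers a b) x y (EuclideanSpace.single k 1)))
    have h3 := congrArg (fun w : Coord n => w i) h2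
    simpa [riemannMap] using h3
  · intro hR u _
    have : riemannMap (randers a b) x y u = 0 := by
      ext i
      simp [riemannMap, hR]
    simp [flagCurvature, this, f0]

end IsRandersPair

end Curvature

/-! ### Randers metrics in a chart -/

section Chart

variable {n : ℕ} {M : Type*} [TopologicalSpace M] [ChartedSpace (Coord n) M]

theorem tangentVec_eq_sum (φ : OpenPartialHomeomorph M (Coord n)) (x y : Coord n) :
    tangentVec φ x y = ∑ i, y i • tangentVec φ x (EuclideanSpace.single i 1) := by
  have h : y = ∑ i, y i • (EuclideanSpace.single i 1 : Coord n) := by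
    ext j
    simp [Pi.single_apply]
  unfold tangentVec
  conv_lhs => rw [h]
  exact (map_sum (mfderiv (𝓡 n) (𝓡 n) φ.symm x) _ _).trans
    (Finset.sum_congr rfl fun i _ => map_smul (mfderiv (𝓡 n) (𝓡 n) φ.symm x) _ _)

/-- The differential of an inverse chart is injective. -/
theorem tangentVec_ne_zero {φ : OpenPartialHomeomorph M (Coord n)} {x : Coord n}
    (hφ : φ ∈ IsManifold.maximalAtlas (𝓡 n) ∞ M) (hx : x ∈ φ.target) {y : Coord n} (hy : y ≠ 0) :
    tangentVec φ x y ≠ 0 := by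
  have h1 : MDifferentiableAt (𝓡 n) (𝓡 n) φ.symm x :=
    ((contMDiffOn_symm_of_mem_maximalAtlas hφ).contMDiffAt
      (φ.open_target.mem_nhds hx)).mdifferentiableAt (by simp)
  have h2 : MDifferentiableAt (𝓡 n) (𝓡 n) φ (φ.symm x) :=
    ((contMDiffOn_of_mem_maximalAtlas hφ).contMDiffAt
      (φ.open_source.mem_nhds (φ.map_target hx))).mdifferentiableAt (by simp)
  have h3 := mfderiv_comp x h2 h1
  have h4 : (φ ∘ φ.symm : Coord n → Coord n) =ᶠ[nhds x] id :=
    (φ.open_target.mem_nhds hx |> Filter.eventually_of_mem) fun z hz => φ.right_inv hz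
  rw [h4.mfderiv_eq, mfderiv_id] at h3
  intro h0
  refine hy ?_
  have h5 : y = mfderiv (𝓡 n) (𝓡 n) φ (φ.symm x) (tangentVec φ x y) := DFunLike.congr_fun h3 y
  exact h5.trans ((congrArg _ h0).trans (map_zero _))

variable [IsManifold (𝓡 n) ∞ M] (F : RandersMetric n M)
  {φ : OpenPartialHomeomorph M (Coord n)} {x : Coord n}

theorem inner_tangentVec (φ : OpenPartialHomeomorph M (Coord n)) (x y : Coord n) :
    F.g.inner (φ.symm x) (tangentVec φ x y) (tangentVec φ x y) = alphaSq (F.a φ) x y := by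
  rw [tangentVec_eq_sum]
  simp only [map_sum, map_smul, _root_.sum_apply, _root_.smul_apply,
    smul_eq_mul, alphaSq, RandersMetric.a, Matrix.of_apply, Finset.mul_sum]
  refine Finset.sum_congr rfl fun i _ => Finset.sum_congr rfl fun j _ => ?_
  rw [F.g.symm _ (tangentVec φ x (EuclideanSpace.single j 1))]
  ring

theorem form_tangentVec (φ : OpenPartialHomeomorph M (Coord n)) (x y : Coord n) :
    F.β.toFun (φ.symm x) (tangentVec φ x y) = betaForm (F.b φ) x y := by
  rw [tangentVec_eq_sum]
  simp only [map_sum, map_smul, smul_eq_mul, betaForm, RandersMetric.b]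
  exact Finset.sum_congr rfl fun _ _ => by ring

theorem localExpr_alpha (φ : OpenPartialHomeomorph M (Coord n)) :
    localExpr F.alpha φ = alphaFun (F.a φ) := by
  ext x y
  simp only [localExpr, RandersMetric.alpha, inner_tangentVec, alphaFun]

theorem localExpr_norm (φ : OpenPartialHomeomorph M (Coord n)) :
    localExpr F.norm φ = randers (F.a φ) (F.b φ) := by
  ext x y
  simp only [localExpr, RandersMetric.norm, RandersMetric.alpha, inner_tangentVec,
    form_tangentVec, randers, alphaFun]

/-- The values of `β / α` are bounded, so that the supremum `‖β‖_α` is not the junk value `0`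
of an unbounded set of reals. -/
theorem bddAbove_form_div (p : M) :
    BddAbove (Set.range fun v : TangentSpace (𝓡 n) p => F.β.toFun p v / √(F.g.inner p v v)) := by
  have h := (F.g.isVonNBounded p).image (F.β.toFun p)
  rw [NormedSpace.isVonNBounded_iff, isBounded_iff_forall_norm_le] at h
  obtain ⟨C, hC⟩ := h
  refine ⟨2 * C, ?_⟩
  rintro _ ⟨v, rfl⟩
  by_cases hv : v = 0
  · have := hC 0 ⟨0, by simp, map_zero _⟩
    simp only [norm_zero] at this
    simp only [hv, map_zero, zero_div]
    linarith
  have hp := F.g.pos p v hv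
  have hs := Real.sqrt_pos.2 hp
  -- Half of the unit vector in the direction of `v` lies in the open unit ball of `α`.
  have h1 := hC (F.β.toFun p ((1 / (2 * √(F.g.inner p v v))) • v)) ⟨_, by
    simp only [Set.mem_ofPred_eq, map_smul, _root_.smul_apply, smul_eq_mul]
    have : (1 / (2 * √(F.g.inner p v v))) * ((1 / (2 * √(F.g.inner p v v))) * F.g.inner p v v)
        = 1 / 4 := by
      rw [← mul_assoc]
      nth_rewrite 3 [← Real.mul_self_sqrt hp.le]
      field_simp
      norm_num
    rw [this]
    norm_num, rfl⟩
  have h2 := (le_abs_self _).trans h1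
  rw [map_smul, smul_eq_mul] at h2
  calc F.β.toFun p v / √(F.g.inner p v v)
      = 2 * (1 / (2 * √(F.g.inner p v v)) * F.β.toFun p v) := by field_simp
    _ ≤ 2 * C := by linarith

/-- The hypothesis `‖β‖_α < 1`, evaluated at a nonzero vector. -/
theorem form_lt_alpha (p : M) {v : TangentSpace (𝓡 n) p} (hv : v ≠ 0) :
    F.β.toFun p v < √(F.g.inner p v v) := by
  have h := (le_ciSup (bddAbove_form_div F p) v).trans_lt (F.norm_lt_one p)
  exact (div_lt_one (Real.sqrt_pos.2 (F.g.pos p v hv))).1 h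

theorem contMDiffOn_tangentVec (hφ : φ ∈ IsManifold.maximalAtlas (𝓡 n) ∞ M) (v : Coord n) :
    ContMDiffOn (𝓡 n) ((𝓡 n).prod (𝓡 n)) ∞
      (fun x => Bundle.TotalSpace.mk' (Coord n) (E := fun p : M => TangentSpace (𝓡 n) p)
        (φ.symm x) (tangentVec φ x v)) φ.target := by
  have h1 := (contMDiffOn_symm_of_mem_maximalAtlas hφ).contMDiffOn_tangentMapWithin
    (m := ∞) (by simp) φ.open_target.uniqueMDiffOn
  have h2 : ContMDiffOn (𝓡 n) ((𝓡 n).prod (𝓡 n)) ∞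
      (fun x : Coord n => (⟨x, v⟩ : TangentBundle (𝓡 n) (Coord n))) φ.target :=
    contMDiffOn_vectorSpace_iff_contDiffOn.2 contDiffOn_const
  refine (h1.comp h2 fun x hx => hx).congr fun x hx => ?_
  simp only [Function.comp_apply, tangentMapWithin, tangentVec,
    mfderivWithin_of_isOpen φ.open_target hx]

theorem smooth_components_a (hφ : φ ∈ IsManifold.maximalAtlas (𝓡 n) ∞ M) (i j : Fin n) :
    ContDiffOn ℝ ∞ (fun x => F.a φ x i j) φ.target := by
  rw [← contMDiffOn_iff_contDiffOn]
  intro x hx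
  have hs := (contMDiffOn_symm_of_mem_maximalAtlas hφ) x hx
  have h : ContMDiffWithinAt (𝓡 n) ((𝓡 n).prod 𝓘(ℝ, ℝ)) ∞
      (fun x => Bundle.TotalSpace.mk' ℝ (E := Bundle.Trivial M ℝ) (φ.symm x)
        (F.g.inner (φ.symm x) (tangentVec φ x (EuclideanSpace.single i 1))
          (tangentVec φ x (EuclideanSpace.single j 1)))) φ.target x := by
    apply ContMDiffWithinAt.clm_bundle_apply₂ (F₁ := Coord n) (F₂ := Coord n)
    · exact ContMDiffAt.comp_contMDiffWithinAt x F.g.contMDiff.contMDiffAt hs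
    · exact contMDiffOn_tangentVec hφ _ x hx
    · exact contMDiffOn_tangentVec hφ _ x hx
  simp only [Bundle.contMDiffWithinAt_totalSpace] at h
  exact h.2

theorem smooth_components_b (hφ : φ ∈ IsManifold.maximalAtlas (𝓡 n) ∞ M) (i : Fin n) :
    ContDiffOn ℝ ∞ (fun x => F.b φ x i) φ.target := by
  rw [← contMDiffOn_iff_contDiffOn]
  intro x hx
  have hs := (contMDiffOn_symm_of_mem_maximalAtlas hφ) x hx
  have h : ContMDiffWithinAt (𝓡 n) ((𝓡 n).prod 𝓘(ℝ, ℝ)) ∞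
      (fun x => Bundle.TotalSpace.mk' ℝ (E := Bundle.Trivial M ℝ) (φ.symm x)
        (F.β.toFun (φ.symm x) (tangentVec φ x (EuclideanSpace.single i 1)))) φ.target x := by
    apply ContMDiffWithinAt.clm_bundle_apply (F₁ := Coord n)
    · exact ContMDiffAt.comp_contMDiffWithinAt x F.β.contMDiff.contMDiffAt hs
    · exact contMDiffOn_tangentVec hφ _ x hx
  simp only [Bundle.contMDiffWithinAt_totalSpace] at h
  exact h.2

/-- In a chart of the maximal atlas, the components of a Randers metric satisfy the local axioms. -/
theorem isRandersPair (hφ : φ ∈ IsManifold.maximalAtlas (𝓡 n) ∞ M) :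
    IsRandersPair φ.target (F.a φ) (F.b φ) where
  isOpen := φ.open_target
  smooth_a := smooth_components_a F hφ
  smooth_b := smooth_components_b F hφ
  symm _ _ _ := F.g.symm _ _ _
  pos x hx y hy := by
    rw [← inner_tangentVec]
    exact F.g.pos _ _ (tangentVec_ne_zero hφ hx hy)
  abs_lt x hx y hy := by
    have h1 := form_lt_alpha F _ (tangentVec_ne_zero hφ hx hy)
    have h2 := form_lt_alpha F _ (tangentVec_ne_zero hφ hx (neg_ne_zero.2 hy))
    rw [inner_tangentVec, form_tangentVec] at h1 h2
    rw [alphaSq_neg, betaForm_neg] at h2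
    exact _root_.abs_lt.2 ⟨by simp only [alphaFun]; linarith, h1⟩

end Chart

end Randers
end

theorem mainTheorem3 (n : ℕ) (M : Type*) [TopologicalSpace M]
    [ChartedSpace (Randers.Coord n) M] [IsManifold (𝓡 n) ∞ M]
    (F : Randers.RandersMetric n M) (hS : Randers.SCurvatureVanishes F.norm) :
    Randers.FlagCurvatureVanishes F.norm ↔
      ∀ φ ∈ IsManifold.maximalAtlas (𝓡 n) ∞ M, ∀ x ∈ φ.target, ∀ y : Randers.Coord n,
        ∀ i k : Fin n, F.RiemannEquation φ x y i k ∧ F.SecondEquation φ x y i k := by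
  refine forall_congr' fun φ => forall_congr' fun hφ => forall_congr' fun x =>
    forall_congr' fun hx => ?_
  have D := Randers.isRandersPair F hφ
  have he : ∀ x ∈ φ.target, ∀ y, Randers.eForm (F.a φ) (F.b φ) x y = 0 := fun x hx =>
    D.eForm_eq_zero hx fun y hy => by
      rw [← Randers.localExpr_norm]
      exact hS φ hφ x hx y hy
  have hR := D.riemannCurv_eq_zero_iff he hx
  rw [Randers.localExpr_norm]
  constructor
  · intro hK y i k
    have h := (hR i k).1 (fun y hy => (D.flagCurvature_eq_zero_iff ⟨hx, hy⟩).1 (hK y) i k) y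
    rw [← Randers.localExpr_alpha] at h
    exact h
  · intro hE y u hu
    refine (D.flagCurvature_eq_zero_iff ⟨hx, hu.ne_zero 0⟩).2 (fun i k => ?_) u hu
    refine (hR i k).2 (fun y => ?_) y (hu.ne_zero 0)
    rw [← Randers.localExpr_alpha]
    exact hE y i k
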